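/- Let $(M^m,g)$ and $(N^n,h)$ be smooth Riemannian manifolds without boundary and let $\phi:(M^m,g)\to(N^n,h)$ be an isometric immersion, i.e. a smooth map with $\phi^*h=g$ (a submanifold $M^m\hookrightarrow (N^n,h)$ with its induced metric). Let $\tau(\phi)=\mathrm{Trace}_g\nabla d\phi$ be the tension field, and let $\eta=\frac1m\mathrm{Trace}_g B$ be the mean curvature vector field, where $B(X,Y)=(\nabla^N_X d\phi(Y))^{\perp}$ is the second fundamental form ($\eta=0$ if $m=0$). The submanifold is minimal if $\eta\equiv0$. For a smooth function $f:M\to(0,\infty)$ the submanifold is $f$-biharmonic if $\phi$ is a critical point of the $f$-bienergy $$E_{2,f}(\phi)=\frac12\int_\Omega f\,|\tau(\phi)|^2\,v_g ,$$ i.e. if $\frac{d}{dt}\big|_{t=0}\frac12\int_K f\,|\tau(\phi_t)|^2v_g=0$ for every compact $K\subset M$ and every smooth variation $(\phi_t)_{t\in\mathbb R}$, $\phi_t:M\to N$, of $\phi_0=\phi$ with $\phi_t=\phi$ outside $K$. The $f$-biharmonic map equation is $$\tau_{2,f}(\phi)=f\,\tau_2(\phi)+(\Delta f)\,\tau(\phi)+2\nabla^{\phi}_{\mathrm{grad}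 f}\,\tau(\phi)=0,$$ $$\tau_2(\phi)=\mathrm{Trace}_g(\nabla^\phi\nabla^\phi-\nabla^\phi_{\nabla^M})\tau(\phi)-\mathrm{Trace}_g R^N(d\phi,\tau(\phi))d\phi ,$$ where $R^N(X,Y)Z=[\nabla^N_X,\nabla^N_Y]Z-\nabla^N_{[X,Y]}Z$. Then the submanifold is minimal if and only if it is $f$-biharmonic for every smooth positive function $f:M\to(0,\infty)$. Likewise, it is minimal if and only if $\tau_{2,f}(\phi)\equiv0$ for every smooth positive function $f:M\to(0,\infty)$. -/

import Mathlib

open scoped Manifold ContDiff Bundle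
open Bundle Set MeasureTheory

noncomputable section

namespace FBiharm

/-! ### Covariant differentiation along a map

Throughout, a Riemannian manifold `(N, h)` of dimension `n` is a smooth manifold modelled on
`EuclideanSpace ℝ (Fin n)` whose tangent bundle carries a smooth Riemannian bundle structure.
For a tangent vector `u` at `y`, the vector field `FiberBundle.extend _ u` is the field defined near
`y` which has constant components in the preferred chart at `y` and takes the value `u` at `y`. -/

section Connection

variable {n : ℕ} {N : Type*} [TopologicalSpace N] [ChartedSpace (EuclideanSpace ℝ (Fin n)) N]

instance instFiniteDimensionalTangentSpace (y : N) :
    FiniteDimensional ℝ (TangentSpace (𝓡 n) y) :=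
  inferInstanceAs (FiniteDimensional ℝ (EuclideanSpace ℝ (Fin n)))

theorem finrank_tangentSpace (y : N) : Module.finrank ℝ (TangentSpace (𝓡 n) y) = n :=
  finrank_euclideanSpace_fin (𝕜 := ℝ) (n := n)

variable [IsManifold (𝓡 n) ∞ N] [RiemannianBundle (fun y : N ↦ TangentSpace (𝓡 n) y)]

/-- The local vector field with constant components in the preferred chart at `y`
and with value `u` at `y`. -/
def constField {y : N} (u : TangentSpace (𝓡 n) y) : Π z : N, TangentSpace (𝓡 n) z :=
  FiberBundle.extend (EuclideanSpace ℝ (Fin n)) u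

variable (n) in
/-- An orthonormal basis of the tangent space at `y`. -/
def onb (y : N) : OrthonormalBasis (Fin n) ℝ (TangentSpace (𝓡 n) y) :=
  (stdOrthonormalBasis ℝ (TangentSpace (𝓡 n) y)).reindex
    (finCongr (finrank_tangentSpace y))

/-- The derivative at `y`, in the direction `u`, of the function `⟨V, W⟩`. -/
def derivInner {y : N} (V W : Π z : N, TangentSpace (𝓡 n) z) (u : TangentSpace (𝓡 n) y) : ℝ :=
  mvfderiv (𝓡 n) (fun z : N ↦ inner ℝ (V z) (W z)) y u

/-- The Christoffel term `Γ(u, w)` of the Levi-Civita connection at `y` in the preferred chart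
at `y`. It is the covariant derivative at `y`, in the direction `u`, of the constant-component field
through `w`; since constant-component fields commute, the Koszul formula for it reads
`2 ⟨Γ(u, w), e⟩ = u ⟨W, E⟩ + w ⟨U, E⟩ - e ⟨U, W⟩`. -/
def christoffel (y : N) (u w : TangentSpace (𝓡 n) y) : TangentSpace (𝓡 n) y :=
  ∑ a, ((1 / 2 : ℝ) * (derivInner (constField w) (constField (onb n y a)) u
      + derivInner (constField u) (constField (onb n y a)) w
      - derivInner (constField u) (constField w) (onb n y a))) • onb n y a

variable {m : ℕ} {M : Type*} [TopologicalSpace M] [ChartedSpace (EuclideanSpace ℝ (Fin m)) M]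

/-- The components of a vector field `W` along `φ`, near `x`, in the preferred chart at `φ x`. -/
def localRep (φ : M → N) (W : Π x : M, TangentSpace (𝓡 n) (φ x)) (x x' : M) :
    EuclideanSpace ℝ (Fin n) :=
  (trivializationAt (EuclideanSpace ℝ (Fin n)) (TangentSpace (𝓡 n) : N → Type _) (φ x)
    ⟨φ x', W x'⟩).2

/-- `covAlong φ W x v` is `∇^φ_v W` at `x`: the covariant derivative of the vector field `W` along
`φ` in the direction `v ∈ T_x M`, for the pull-back of the Levi-Civita connection of `N`. In the
chart at `φ x` its components are `v(W^a) + Γ^a_{bc} dφ^b(v) W^c`. -/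
def covAlong (φ : M → N) (W : Π x : M, TangentSpace (𝓡 n) (φ x)) (x : M)
    (v : TangentSpace (𝓡 m) x) : TangentSpace (𝓡 n) (φ x) :=
  (trivializationAt (EuclideanSpace ℝ (Fin n)) (TangentSpace (𝓡 n) : N → Type _) (φ x)).symm (φ x)
      (mvfderiv (𝓡 m) (localRep φ W x) x v)
    + christoffel (φ x) (mfderiv (𝓡 m) (𝓡 n) φ x v) (W x)

/-- `nabla Y y u` is `∇_u Y` at `y`, for the Levi-Civita connection of `N`. -/
def nabla (Y : Π y : N, TangentSpace (𝓡 n) y) (y : N) (u : TangentSpace (𝓡 n) y) :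
    TangentSpace (𝓡 n) y :=
  covAlong (id : N → N) Y y u

/-- The curvature `R(u, v) w = [∇_U, ∇_V] W - ∇_{[U, V]} W` at `y`, where `U, V, W` are any local
extensions of `u, v, w`. -/
def curvature (y : N) (u v w : TangentSpace (𝓡 n) y) : TangentSpace (𝓡 n) y :=
  nabla (fun z ↦ nabla (constField w) z (constField v z)) y u
    - nabla (fun z ↦ nabla (constField w) z (constField u z)) y v
    - nabla (constField w) y (VectorField.mlieBracket (𝓡 n) (constField u) (constField v) y)

end Connection

section Maps

variable (m n : ℕ)
  {M : Type*} [TopologicalSpace M] [ChartedSpace (EuclideanSpace ℝ (Fin m)) M]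
  [IsManifold (𝓡 m) ∞ M] [RiemannianBundle (fun x : M ↦ TangentSpace (𝓡 m) x)]
  {N : Type*} [TopologicalSpace N] [ChartedSpace (EuclideanSpace ℝ (Fin n)) N]
  [IsManifold (𝓡 n) ∞ N] [RiemannianBundle (fun y : N ↦ TangentSpace (𝓡 n) y)]

/-- The vector field `dφ(X)` along `φ`. -/
def pushField (φ : M → N) (X : Π x : M, TangentSpace (𝓡 m) x) (x : M) : TangentSpace (𝓡 n) (φ x) :=
  mfderiv (𝓡 m) (𝓡 n) φ x (X x)

/-- The tension field `τ(φ) = Trace_g ∇dφ`. -/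
def tension (φ : M → N) (x : M) : TangentSpace (𝓡 n) (φ x) :=
  ∑ i, (covAlong φ (pushField m n φ (constField (onb m x i))) x (onb m x i)
    - mfderiv (𝓡 m) (𝓡 n) φ x (nabla (constField (onb m x i)) x (onb m x i)))

/-! ### Minimal submanifolds -/

/-- An isometric immersion: a smooth map with `φ^* h = g`. -/
structure IsIsometricImmersion (φ : M → N) : Prop where
  smooth : ContMDiff (𝓡 m) (𝓡 n) ∞ φ
  isometric : ∀ (x : M) (u v : TangentSpace (𝓡 m) x),
    inner ℝ (mfderiv (𝓡 m) (𝓡 n) φ x u) (mfderiv (𝓡 m) (𝓡 n) φ x v) = inner ℝ u v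

/-- The normal space at `x`: the orthogonal complement of `dφ(T_x M)` in `T_{φ x} N`. -/
def normalSpace (φ : M → N) (x : M) : Submodule ℝ (TangentSpace (𝓡 n) (φ x)) :=
  (LinearMap.range (mfderiv (𝓡 m) (𝓡 n) φ x).toLinearMap)ᗮ

/-- The second fundamental form `B(u, v) = (∇^N_U dφ(V))^⊥` of an immersion. -/
def secondFundamentalForm (φ : M → N) (x : M) (u v : TangentSpace (𝓡 m) x) :
    TangentSpace (𝓡 n) (φ x) :=
  (normalSpace m n φ x).starProjection (covAlong φ (pushField m n φ (constField v)) x u)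

/-- The mean curvature vector field `η = (1/m) Trace_g B`. -/
def meanCurvature (φ : M → N) (x : M) : TangentSpace (𝓡 n) (φ x) :=
  (m : ℝ)⁻¹ • ∑ i, secondFundamentalForm m n φ x (onb m x i) (onb m x i)

/-- A submanifold is minimal if its mean curvature vector field vanishes identically. -/
def IsMinimal (φ : M → N) : Prop := ∀ x, meanCurvature m n φ x = 0

/-! ### `f`-biharmonic maps as critical points of the `f`-bienergy -/

section Volume

variable [MeasurableSpace M]

/-- The Riemannian measure of the domain of the preferred chart at `x₀`, which in the coordinates of
that chart is `√(det (g_ij))` times Lebesgue measure. -/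
def chartVolume (x₀ : M) : Measure M :=
  ((volume.restrict (chartAt (EuclideanSpace ℝ (Fin m)) x₀).target).map
    (chartAt (EuclideanSpace ℝ (Fin m)) x₀).symm).withDensity fun y ↦
      ENNReal.ofReal (Real.sqrt (Matrix.of fun i j : Fin m ↦
        (inner ℝ (constField (y := x₀) (EuclideanSpace.single i (1 : ℝ)) y)
          (constField (y := x₀) (EuclideanSpace.single j (1 : ℝ)) y) : ℝ)).det)

variable (M) in
/-- The sequence `(c k, S k)` consists of compact sets `S k`, each inside the domain of the preferred
chart at `c k`, whose interiors cover `M`. -/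
def IsCompactChartCover (p : ℕ → M × Set M) : Prop :=
  (∀ k, IsCompact (p k).2 ∧ (p k).2 ⊆ (chartAt (EuclideanSpace ℝ (Fin m)) (p k).1).source) ∧
    ⋃ k, interior (p k).2 = univ

open Classical in
variable (M) in
/-- The Riemannian volume measure `v_g`: the members of a sequence of compact sets which cover `M`,
each inside a chart domain, are made disjoint, and the Riemannian measures of the pieces are added
up. (By the change of variables formula the choice of the sequence is irrelevant. On a second
countable manifold there is such a sequence unless `M` is empty.) -/
def riemannianVolume : Measure M :=
  if h : ∃ p : ℕ → M × Set M, IsCompactChartCover m M p then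
    Measure.sum fun k ↦
      (chartVolume m (h.choose k).1).restrict (disjointed (fun j ↦ (h.choose j).2) k)
  else 0

/-- The `f`-bienergy `E_{2,f}(φ) = (1/2) ∫_K f |τ(φ)|² v_g` of `φ` over `K`. -/
def fBienergy (f : M → ℝ) (K : Set M) (φ : M → N) : ℝ :=
  (1 / 2) * ∫ x in K, f x * ‖tension m n φ x‖ ^ 2 ∂(riemannianVolume m M)

/-- A smooth variation `(Φ_t)` of `φ` supported in `K`. -/
structure IsVariation (φ : M → N) (K : Set M) (Φ : ℝ → M → N) : Prop where
  smooth : ContMDiff (𝓘(ℝ, ℝ).prod (𝓡 m)) (𝓡 n) ∞ (fun p : ℝ × M ↦ Φ p.1 p.2)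
  zero : Φ 0 = φ
  eq_off : ∀ t, ∀ x ∉ K, Φ t x = φ x

/-- `φ` is `f`-biharmonic if it is a critical point of the `f`-bienergy over compact sets: the first
derivative of the `f`-bienergy vanishes for every smooth compactly supported variation. -/
def IsFBiharmonic (φ : M → N) (f : M → ℝ) : Prop :=
  ∀ (K : Set M) (Φ : ℝ → M → N), IsCompact K → IsVariation m n φ K Φ →
    HasDerivAt (fun t ↦ fBienergy m n f K (Φ t)) 0 0

end Volume

/-! ### The `f`-biharmonic map equation -/

/-- The Laplacian `Δf = Trace_g ∇df` of a function on `M`. -/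
def laplacian (f : M → ℝ) (x : M) : ℝ :=
  ∑ i, (mvfderiv (𝓡 m) (fun z : M ↦ mvfderiv (𝓡 m) f z (constField (onb m x i) z)) x (onb m x i)
    - mvfderiv (𝓡 m) f x (nabla (constField (onb m x i)) x (onb m x i)))

/-- The gradient of a function on `M`. -/
def grad (f : M → ℝ) (x : M) : TangentSpace (𝓡 m) x :=
  ∑ i, mvfderiv (𝓡 m) f x (onb m x i) • onb m x i

/-- The rough Laplacian `Trace_g (∇^φ ∇^φ - ∇^φ_{∇^M}) V` of a vector field `V` along `φ`. -/
def roughLaplacian (φ : M → N) (V : Π x : M, TangentSpace (𝓡 n) (φ x)) (x : M) :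
    TangentSpace (𝓡 n) (φ x) :=
  ∑ i, (covAlong φ (fun z ↦ covAlong φ V z (constField (onb m x i) z)) x (onb m x i)
    - covAlong φ V x (nabla (constField (onb m x i)) x (onb m x i)))

/-- The bitension field
`τ₂(φ) = Trace_g (∇^φ ∇^φ - ∇^φ_{∇^M}) τ(φ) - Trace_g R^N(dφ, τ(φ)) dφ`. -/
def bitension (φ : M → N) (x : M) : TangentSpace (𝓡 n) (φ x) :=
  roughLaplacian m n φ (tension m n φ) x
    - ∑ i, curvature (φ x) (mfderiv (𝓡 m) (𝓡 n) φ x (onb m x i)) (tension m n φ x)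
        (mfderiv (𝓡 m) (𝓡 n) φ x (onb m x i))

/-- The `f`-bitension field `τ_{2,f}(φ) = f τ₂(φ) + (Δf) τ(φ) + 2 ∇^φ_{grad f} τ(φ)`. -/
def fBitension (φ : M → N) (f : M → ℝ) (x : M) : TangentSpace (𝓡 n) (φ x) :=
  f x • bitension m n φ x + laplacian m f x • tension m n φ x
    + (2 : ℝ) • covAlong φ (tension m n φ) x (grad m f x)

end Maps

end FBiharm

end

/-!
For an isometric immersion `∇dφ` takes normal values, so `τ(φ) = m η` and minimality means that `φ`
is harmonic. A harmonic map trivially solves both problems: it satisfies the equation, and it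
minimises every `f`-bienergy.

For the equation, compare `f = 1` with a function that equals `1 + |x - x₀|²` near `x₀`: the gradient
of the latter vanishes at `x₀` while its Laplacian is positive there, so the difference of the two
equations at `x₀` is a nonzero multiple of `τ(φ)(x₀)`.

For the variational problem, letting `f` vary turns criticality into the pointwise identity
`∂ₜ|τ(φ_t)|² = 0` at `t = 0`. A variation that moves `φ`, in coordinates near `x₀`, by
`t |x - x₀|² τ(φ)(x₀)` leaves the `1`-jet at `x₀` unchanged and multiplies `τ(φ)(x₀)` by `1 + 2tT`
with `T > 0`, so the identity forces `τ(φ)(x₀) = 0`.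
-/

noncomputable section

namespace FBiharm

open Filter Topology

set_option maxSynthPendingDepth 3

section CovariantHessian

variable {E F K : Type*} [NormedAddCommGroup E] [NormedSpace ℝ E]
  [NormedAddCommGroup F] [NormedSpace ℝ F] [NormedAddCommGroup K] [NormedSpace ℝ K]

/-- The Christoffel symbols of the first kind of a metric `G` on a vector space: the Koszul formula
for constant vector fields. -/
def christoffelFirst (G : E → E →L[ℝ] E →L[ℝ] ℝ) (p : E) : E →L[ℝ] E →L[ℝ] E →L[ℝ] ℝ :=
  let D : E →L[ℝ] E →L[ℝ] E →L[ℝ] ℝ := fderiv ℝ G p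
  let T : (E →L[ℝ] E →L[ℝ] ℝ) →L[ℝ] (E →L[ℝ] E →L[ℝ] ℝ) :=
    (ContinuousLinearMap.flipₗᵢ ℝ E E ℝ).toContinuousLinearEquiv.toContinuousLinearMap
  (1 / 2 : ℝ) • (D + D.flip - T.comp D.flip)

theorem christoffelFirst_apply (G : E → E →L[ℝ] E →L[ℝ] ℝ) (p u w e : E) :
    christoffelFirst G p u w e = (1 / 2 : ℝ) * (fderiv ℝ G p u w e + fderiv ℝ G p w u e
      - fderiv ℝ G p e u w) := by
  simp [christoffelFirst]

/-- The Christoffel symbols of the second kind of a metric `G` on a vector space, for use where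
`G p` is invertible: elsewhere `ContinuousLinearMap.inverse` is zero. -/
def christoffelSecond (G : E → E →L[ℝ] E →L[ℝ] ℝ) (p : E) : E →L[ℝ] E →L[ℝ] E :=
  (ContinuousLinearMap.compL ℝ E (E →L[ℝ] ℝ) E (G p).inverse).comp (christoffelFirst G p)

theorem metric_christoffelSecond {G : E → E →L[ℝ] E →L[ℝ] ℝ} {p : E} (hG : (G p).IsInvertible)
    (u w e : E) :
    G p (christoffelSecond G p u w) e = (1 / 2 : ℝ) * (fderiv ℝ G p u w e + fderiv ℝ G p w u e
      - fderiv ℝ G p e u w) := by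
  rw [← christoffelFirst_apply, christoffelSecond, ContinuousLinearMap.comp_apply,
    ContinuousLinearMap.compL_apply, ContinuousLinearMap.comp_apply, hG.self_apply_inverse]

/-- The covariant Hessian `∇dψ` of a map `ψ` between vector spaces with metrics `G` and `H`. -/
def covHess (G : E → E →L[ℝ] E →L[ℝ] ℝ) (H : F → F →L[ℝ] F →L[ℝ] ℝ) (ψ : E → F) (p : E) :
    E →L[ℝ] E →L[ℝ] F :=
  fderiv ℝ (fderiv ℝ ψ) p
    + (christoffelSecond H (ψ p)).bilinearComp (fderiv ℝ ψ p) (fderiv ℝ ψ p)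
    - (ContinuousLinearMap.compL ℝ E E F (fderiv ℝ ψ p)).comp (christoffelSecond G p)

theorem covHess_apply (G : E → E →L[ℝ] E →L[ℝ] ℝ) (H : F → F →L[ℝ] F →L[ℝ] ℝ) (ψ : E → F)
    (p u w : E) :
    covHess G H ψ p u w = fderiv ℝ (fderiv ℝ ψ) p u w
      + christoffelSecond H (ψ p) (fderiv ℝ ψ p u) (fderiv ℝ ψ p w)
      - fderiv ℝ ψ p (christoffelSecond G p u w) := by
  simp [covHess]

theorem covHess_congr {G : E → E →L[ℝ] E →L[ℝ] ℝ} {H : F → F →L[ℝ] F →L[ℝ] ℝ} {ψ χ : E → F}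
    {p : E} (h : ψ =ᶠ[𝓝 p] χ) : covHess G H ψ p = covHess G H χ p := by
  simp only [covHess, h.fderiv_eq, h.fderiv.fderiv_eq, h.eq_of_nhds]

theorem differentiableAt_fderiv_of_contDiffAt_two {ψ : E → F} {p : E}
    (hψ : ContDiffAt ℝ 2 ψ p) : DifferentiableAt ℝ (fderiv ℝ ψ) p :=
  (hψ.fderiv_right (m := 1) (by norm_num)).differentiableAt (by norm_num)

theorem fderiv_pullback_metric {G : E → E →L[ℝ] E →L[ℝ] ℝ} {H : F → F →L[ℝ] F →L[ℝ] ℝ}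
    {ψ : E → F} {p : E} (hψ : ContDiffAt ℝ 2 ψ p) (hG : DifferentiableAt ℝ G p)
    (hH : DifferentiableAt ℝ H (ψ p))
    (hpull : ∀ᶠ q in 𝓝 p, ∀ u w, G q u w = H (ψ q) (fderiv ℝ ψ q u) (fderiv ℝ ψ q w))
    (c a b : E) :
    fderiv ℝ G p c a b =
      fderiv ℝ H (ψ p) (fderiv ℝ ψ p c) (fderiv ℝ ψ p a) (fderiv ℝ ψ p b)
      + H (ψ p) (fderiv ℝ (fderiv ℝ ψ) p c a) (fderiv ℝ ψ p b)
      + H (ψ p) (fderiv ℝ ψ p a) (fderiv ℝ (fderiv ℝ ψ) p c b) := by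
  have hDψ (v : E) : HasFDerivAt (fun q ↦ fderiv ℝ ψ q v) _ p :=
    (differentiableAt_fderiv_of_contDiffAt_two hψ).hasFDerivAt.clm_apply (hasFDerivAt_const v p)
  have hHψ : HasFDerivAt (fun q ↦ H (ψ q)) ((fderiv ℝ H (ψ p)).comp (fderiv ℝ ψ p)) p :=
    hH.hasFDerivAt.comp p (hψ.differentiableAt (by norm_num)).hasFDerivAt
  have hGab : HasFDerivAt (fun q ↦ G q a b) _ p :=
    (hG.hasFDerivAt.clm_apply (hasFDerivAt_const a p)).clm_apply (hasFDerivAt_const b p)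
  have hHab := ((hHψ.clm_apply (hDψ a)).clm_apply (hDψ b)).congr_of_eventuallyEq
    (hpull.mono fun q hq ↦ hq a b)
  have heq := DFunLike.congr_fun (hGab.unique hHab) c
  simp only [_root_.add_apply, ContinuousLinearMap.comp_apply, ContinuousLinearMap.flip_apply,
    _root_.zero_apply, map_zero, zero_add] at heq
  rw [heq]
  ring

theorem covHess_normal {G : E → E →L[ℝ] E →L[ℝ] ℝ} {H : F → F →L[ℝ] F →L[ℝ] ℝ} {ψ : E → F}
    {p : E} (hψ : ContDiffAt ℝ 2 ψ p) (hG : DifferentiableAt ℝ G p)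
    (hH : DifferentiableAt ℝ H (ψ p)) (hGi : (G p).IsInvertible) (hHi : (H (ψ p)).IsInvertible)
    (hsymm : ∀ u w, H (ψ p) u w = H (ψ p) w u)
    (hpull : ∀ᶠ q in 𝓝 p, ∀ u w, G q u w = H (ψ q) (fderiv ℝ ψ q u) (fderiv ℝ ψ q w))
    (u w e : E) :
    H (ψ p) (covHess G H ψ p u w) (fderiv ℝ ψ p e) = 0 := by
  have hDDsymm : ∀ a b, fderiv ℝ (fderiv ℝ ψ) p a b = fderiv ℝ (fderiv ℝ ψ) p b a :=
    hψ.isSymmSndFDerivAt (by simp)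
  rw [covHess_apply, map_sub, map_add, _root_.sub_apply, _root_.add_apply,
    metric_christoffelSecond hHi, ← hpull.self_of_nhds, metric_christoffelSecond hGi,
    fderiv_pullback_metric hψ hG hH hpull, fderiv_pullback_metric hψ hG hH hpull,
    fderiv_pullback_metric hψ hG hH hpull, hDDsymm w u, hDDsymm u e, hDDsymm w e, hDDsymm e w,
    hsymm (fderiv ℝ (fderiv ℝ ψ) p e u)]
  ring

theorem covHess_comp {G : E → E →L[ℝ] E →L[ℝ] ℝ} {H : F → F →L[ℝ] F →L[ℝ] ℝ}
    {J : K → K →L[ℝ] K →L[ℝ] ℝ} {ψ : E → F} {χ : F → K} {p : E}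
    (hψ : ContDiffAt ℝ 2 ψ p) (hχ : ContDiffAt ℝ 2 χ (ψ p)) (u w : E) :
    covHess G J (χ ∘ ψ) p u w = fderiv ℝ χ (ψ p) (covHess G H ψ p u w)
      + covHess H J χ (ψ p) (fderiv ℝ ψ p u) (fderiv ℝ ψ p w) := by
  have hψd : DifferentiableAt ℝ ψ p := hψ.differentiableAt (by norm_num)
  have hchain : fderiv ℝ (χ ∘ ψ) =ᶠ[𝓝 p] fun q ↦ (fderiv ℝ χ (ψ q)).comp (fderiv ℝ ψ q) := by
    filter_upwards [hψ.eventually (by simp),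
      hψd.continuousAt.eventually (hχ.eventually (by simp))] with q hψq hχq
    exact fderiv_comp q (hχq.differentiableAt (by norm_num)) (hψq.differentiableAt (by norm_num))
  have hsecond : fderiv ℝ (fderiv ℝ (χ ∘ ψ)) p = _ := hchain.fderiv_eq.trans
    (((differentiableAt_fderiv_of_contDiffAt_two hχ).hasFDerivAt.comp p hψd.hasFDerivAt).clm_comp
      (differentiableAt_fderiv_of_contDiffAt_two hψ).hasFDerivAt).fderiv
  simp only [covHess_apply, hsecond, hchain.self_of_nhds, Function.comp_apply, _root_.add_apply,
    ContinuousLinearMap.comp_apply, ContinuousLinearMap.compL_apply,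
    ContinuousLinearMap.flip_apply, map_add, map_sub]
  abel

theorem covHess_natural {E' F' : Type*} [NormedAddCommGroup E'] [NormedSpace ℝ E']
    [NormedAddCommGroup F'] [NormedSpace ℝ F']
    {G : E → E →L[ℝ] E →L[ℝ] ℝ} {H : F → F →L[ℝ] F →L[ℝ] ℝ}
    {G' : E' → E' →L[ℝ] E' →L[ℝ] ℝ} {H' : F' → F' →L[ℝ] F' →L[ℝ] ℝ}
    {ψ : E → F} {ψ' : E' → F'} {θ : E → E'} {κ : F → F'} {p : E}
    (hψ : ContDiffAt ℝ 2 ψ p) (hψ' : ContDiffAt ℝ 2 ψ' (θ p))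
    (hθ : ContDiffAt ℝ 2 θ p) (hκ : ContDiffAt ℝ 2 κ (ψ p))
    (hθ_affine : covHess G G' θ p = 0) (hκ_affine : covHess H H' κ (ψ p) = 0)
    (hcomm : κ ∘ ψ =ᶠ[𝓝 p] ψ' ∘ θ) (u w : E) :
    fderiv ℝ κ (ψ p) (covHess G H ψ p u w)
      = covHess G' H' ψ' (θ p) (fderiv ℝ θ p u) (fderiv ℝ θ p w) := by
  have hleft := covHess_comp (G := G) (H := H) (J := H') hψ hκ u w
  have hright := covHess_comp (G := G) (H := G') (J := H') hθ hψ' u w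
  rw [covHess_congr hcomm, hright, hθ_affine, hκ_affine] at hleft
  simpa using hleft.symm

theorem isInvertible_of_pos [FiniteDimensional ℝ E] {B : E →L[ℝ] E →L[ℝ] ℝ}
    (hB : ∀ u, u ≠ 0 → 0 < B u u) : B.IsInvertible := by
  have hinj : Function.Injective B := by
    rw [injective_iff_map_eq_zero]
    intro u hu
    by_contra hne
    simpa [hu] using hB u hne
  have hfinrank : Module.finrank ℝ E = Module.finrank ℝ (E →L[ℝ] ℝ) := by
    rw [← (LinearMap.toContinuousLinearMap (𝕜 := ℝ) (E := E) (F' := ℝ)).finrank_eq]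
    exact Subspace.dual_finrank_eq.symm
  exact ⟨(LinearEquiv.ofInjectiveOfFinrankEq (B : E →ₗ[ℝ] E →L[ℝ] ℝ) hinj
    hfinrank).toContinuousLinearEquiv, by ext; rfl⟩

end CovariantHessian

section MetricTrace

variable {E F : Type*} [NormedAddCommGroup E] [NormedSpace ℝ E] [FiniteDimensional ℝ E]
  [NormedAddCommGroup F] [NormedSpace ℝ F]

/-- The trace of a bilinear map `L` with respect to a scalar product `g`, as a contraction over an
arbitrary basis, so that it depends smoothly on `g`. -/
def metricTrace (g : E →L[ℝ] E →L[ℝ] ℝ) (L : E →L[ℝ] E →L[ℝ] F) : F :=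
  ∑ i, L (g.inverse (LinearMap.toContinuousLinearMap ((Module.finBasis ℝ E).coord i)))
    (Module.finBasis ℝ E i)

variable {ι : Type*} [Fintype ι] [DecidableEq ι] {g : E →L[ℝ] E →L[ℝ] ℝ} {e : ι → E}

theorem sum_metric_smul_of_orthonormal (hcard : Fintype.card ι = Module.finrank ℝ E)
    (he : ∀ i j, g (e i) (e j) = if i = j then 1 else 0) (v : E) :
    ∑ j, g (e j) v • e j = v := by
  have hli : LinearIndependent ℝ e := by
    rw [Fintype.linearIndependent_iff]
    intro c hc i
    simpa [he, map_sum] using congrArg (g (e i)) hc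
  have hspan : v ∈ Submodule.span ℝ (range e) := by
    rw [hli.span_eq_top_of_card_eq_finrank' hcard]
    trivial
  obtain ⟨c, rfl⟩ := (Submodule.mem_span_range_iff_exists_fun ℝ).1 hspan
  simp [map_sum, he]

theorem metricTrace_eq_sum (hg : g.IsInvertible) (L : E →L[ℝ] E →L[ℝ] F)
    (hcard : Fintype.card ι = Module.finrank ℝ E)
    (he : ∀ i j, g (e i) (e j) = if i = j then 1 else 0) :
    metricTrace g L = ∑ i, L (e i) (e i) := by
  let b := Module.finBasis ℝ E
  let β := fun i ↦ g.inverse (LinearMap.toContinuousLinearMap (b.coord i))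
  have hdual : ∀ j, ∑ i, g (e j) (b i) • β i = e j := by
    intro j
    apply hg.injective
    ext v
    simp only [β, map_sum, map_smul, hg.self_apply_inverse, _root_.sum_apply, _root_.smul_apply,
      LinearMap.coe_toContinuousLinearMap', Module.Basis.coord_apply, smul_eq_mul]
    conv_rhs => rw [← b.sum_repr v]
    simp only [map_sum, map_smul, smul_eq_mul, mul_comm]
  calc metricTrace g L
      = ∑ i, ∑ j, L (β i) (g (e j) (b i) • e j) := by
        simp only [← map_sum, sum_metric_smul_of_orthonormal hcard he]
        rfl
    _ = ∑ j, L (∑ i, g (e j) (b i) • β i) (e j) := by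
        rw [Finset.sum_comm]
        simp [map_sum, _root_.sum_apply]
    _ = ∑ j, L (e j) (e j) := by simp only [hdual]

end MetricTrace

section Smoothness

variable {E F D : Type*} [NormedAddCommGroup E] [NormedSpace ℝ E]
  [NormedAddCommGroup F] [NormedSpace ℝ F] [NormedAddCommGroup D] [NormedSpace ℝ D]

theorem contDiffAt_inverse_metric [CompleteSpace E] {G : D → E →L[ℝ] E →L[ℝ] ℝ} {x : D}
    (hG : ContDiffAt ℝ ∞ G x) (hGi : (G x).IsInvertible) :
    ContDiffAt ℝ ∞ (fun y ↦ (G y).inverse) x :=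
  hGi.contDiffAt_map_inverse.comp x hG

set_option synthInstance.maxHeartbeats 200000 in
theorem contDiffAt_christoffelSecond [CompleteSpace E] {G : E → E →L[ℝ] E →L[ℝ] ℝ} {p : E}
    (hG : ContDiffAt ℝ ∞ G p) (hGi : (G p).IsInvertible) :
    ContDiffAt ℝ ∞ (christoffelSecond G) p := by
  have hD : ContDiffAt ℝ ∞ (fderiv ℝ G) p := hG.fderiv_right (m := ∞) (by simp)
  have hflip : ContDiffAt ℝ ∞ (fun q ↦ (fderiv ℝ G q).flip) p :=
    (ContinuousLinearMap.flipₗᵢ ℝ E E (E →L[ℝ] ℝ)).contDiff.contDiffAt.comp p hD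
  have hfirst : ContDiffAt ℝ ∞ (christoffelFirst G) p :=
    ((hD.add hflip).sub (contDiffAt_const.clm_comp hflip)).const_smul _
  exact ((ContinuousLinearMap.compL ℝ E (E →L[ℝ] ℝ) E).contDiff.contDiffAt.comp p
    (contDiffAt_inverse_metric hG hGi)).clm_comp hfirst

theorem contDiffAt_covHess [CompleteSpace E] [CompleteSpace F] {G : E → E →L[ℝ] E →L[ℝ] ℝ}
    {H : F → F →L[ℝ] F →L[ℝ] ℝ} {Ψ : D × E → F} {z : D × E}
    (hΨ : ContDiffAt ℝ ∞ Ψ z) (hG : ContDiffAt ℝ ∞ G z.2) (hGi : (G z.2).IsInvertible)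
    (hH : ContDiffAt ℝ ∞ H (Ψ z)) (hHi : (H (Ψ z)).IsInvertible) {u w : D × E → E}
    (hu : ContDiffAt ℝ ∞ u z) (hw : ContDiffAt ℝ ∞ w z) :
    ContDiffAt ℝ ∞
      (fun y : D × E ↦ covHess G H (fun q ↦ Ψ (y.1, q)) y.2 (u y) (w y)) z := by
  have hD : ContDiffAt ℝ ∞ (fun y : D × E ↦ fderiv ℝ (fun q ↦ Ψ (y.1, q)) y.2) z :=
    ContDiffAt.fderiv (f := fun (y : D × E) q ↦ Ψ (y.1, q)) (n := ∞)
      (ContDiffAt.comp (g := Ψ) (z, z.2) hΨ (by fun_prop)) contDiffAt_snd (by simp)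
  have hDD : ContDiffAt ℝ ∞
      (fun y : D × E ↦ fderiv ℝ (fderiv ℝ (fun q ↦ Ψ (y.1, q))) y.2) z :=
    ContDiffAt.fderiv (f := fun (y : D × E) q ↦ fderiv ℝ (fun q ↦ Ψ (y.1, q)) q) (n := ∞)
      (ContDiffAt.comp (g := fun y : D × E ↦ fderiv ℝ (fun q ↦ Ψ (y.1, q)) y.2) (z, z.2) hD
        (f := fun y : (D × E) × E ↦ (y.1.1, y.2)) (by fun_prop)) contDiffAt_snd (by simp)
  simp only [covHess_apply]
  refine (((hDD.clm_apply hu).clm_apply hw).add ?_).sub (hD.clm_apply ?_)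
  · exact (((contDiffAt_christoffelSecond hH hHi).comp z hΨ).clm_apply
      (hD.clm_apply hu)).clm_apply (hD.clm_apply hw)
  · exact (((contDiffAt_christoffelSecond hG hGi).comp z contDiffAt_snd).clm_apply hu).clm_apply hw

theorem contDiffAt_metricTrace_covHess [FiniteDimensional ℝ E] [CompleteSpace F]
    {G : E → E →L[ℝ] E →L[ℝ] ℝ} {H : F → F →L[ℝ] F →L[ℝ] ℝ} {Ψ : D × E → F} {z : D × E}
    (hΨ : ContDiffAt ℝ ∞ Ψ z) (hG : ContDiffAt ℝ ∞ G z.2) (hGi : (G z.2).IsInvertible)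
    (hH : ContDiffAt ℝ ∞ H (Ψ z)) (hHi : (H (Ψ z)).IsInvertible) :
    ContDiffAt ℝ ∞
      (fun y : D × E ↦ metricTrace (G y.2) (covHess G H (fun q ↦ Ψ (y.1, q)) y.2)) z := by
  have := FiniteDimensional.complete ℝ E
  exact ContDiffAt.sum fun i _ ↦ contDiffAt_covHess hΨ hG hGi hH hHi
    ((contDiffAt_inverse_metric (hG.comp z contDiffAt_snd) hGi).clm_apply contDiffAt_const)
    contDiffAt_const

end Smoothness

section VectorDerivative

variable {n : ℕ} {N : Type*} [TopologicalSpace N] [ChartedSpace (EuclideanSpace ℝ (Fin n)) N]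
  {V : Type*} [NormedAddCommGroup V] [NormedSpace ℝ V]

theorem mvfderiv_congr {f g : N → V} {z : N} (h : f =ᶠ[𝓝 z] g) :
    (mvfderiv (𝓡 n) f z : TangentSpace (𝓡 n) z → V) = mvfderiv (𝓡 n) g z := by
  ext u
  simp only [mvfderiv, ContinuousLinearMap.comp_apply]
  rw [h.mfderiv_eq]
  rfl

end VectorDerivative

section Frames

variable {n : ℕ} {N : Type*} [TopologicalSpace N] [ChartedSpace (EuclideanSpace ℝ (Fin n)) N]
  [IsManifold (𝓡 n) ∞ N]

/-- The components of tangent vectors at `z` in the preferred chart at `y₀`; the value is junk if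
`z` is outside the domain of that chart. -/
def coframe (y₀ z : N) : TangentSpace (𝓡 n) z →L[ℝ] EuclideanSpace ℝ (Fin n) :=
  (trivializationAt (EuclideanSpace ℝ (Fin n)) (TangentSpace (𝓡 n) : N → Type _)
    y₀).continuousLinearMapAt ℝ z

/-- The tangent vector at `z` with given components in the preferred chart at `y₀`; the value is
junk if `z` is outside the domain of that chart. -/
def frame (y₀ z : N) : EuclideanSpace ℝ (Fin n) →L[ℝ] TangentSpace (𝓡 n) z :=
  (trivializationAt (EuclideanSpace ℝ (Fin n)) (TangentSpace (𝓡 n) : N → Type _) y₀).symmL ℝ z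

theorem mem_baseSet_of_mem_source {y₀ z : N} (hz : z ∈ (extChartAt (𝓡 n) y₀).source) :
    z ∈ (trivializationAt (EuclideanSpace ℝ (Fin n)) (TangentSpace (𝓡 n) : N → Type _)
      y₀).baseSet := by
  simpa using hz

theorem coframe_frame {y₀ z : N} (hz : z ∈ (extChartAt (𝓡 n) y₀).source)
    (u : EuclideanSpace ℝ (Fin n)) : coframe y₀ z (frame y₀ z u) = u :=
  Trivialization.continuousLinearMapAt_symmL _ (mem_baseSet_of_mem_source hz) u

theorem frame_coframe {y₀ z : N} (hz : z ∈ (extChartAt (𝓡 n) y₀).source)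
    (u : TangentSpace (𝓡 n) z) : frame y₀ z (coframe y₀ z u) = u :=
  Trivialization.symmL_continuousLinearMapAt _ (mem_baseSet_of_mem_source hz) u

theorem coframe_eq_zero_iff {y₀ z : N} (hz : z ∈ (extChartAt (𝓡 n) y₀).source)
    {u : TangentSpace (𝓡 n) z} : coframe y₀ z u = 0 ↔ u = 0 :=
  ⟨fun h ↦ by rw [← frame_coframe hz u, h, map_zero], fun h ↦ by rw [h, map_zero]⟩

theorem trivializationAt_snd {y₀ z : N} (hz : z ∈ (extChartAt (𝓡 n) y₀).source)
    (u : TangentSpace (𝓡 n) z) :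
    (trivializationAt (EuclideanSpace ℝ (Fin n)) (TangentSpace (𝓡 n) : N → Type _) y₀ ⟨z, u⟩).2
      = coframe y₀ z u := by
  rw [coframe, Trivialization.continuousLinearMapAt_apply,
    Trivialization.coe_linearMapAt_of_mem _ (mem_baseSet_of_mem_source hz)]

theorem trivializationAt_symm {y₀ z : N} (hz : z ∈ (extChartAt (𝓡 n) y₀).source)
    (u : EuclideanSpace ℝ (Fin n)) :
    (trivializationAt (EuclideanSpace ℝ (Fin n)) (TangentSpace (𝓡 n) : N → Type _) y₀).symm z u
      = frame y₀ z u :=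
  (Trivialization.symmL_apply (R := ℝ) _ (mem_baseSet_of_mem_source hz) u).symm

theorem constField_eq_frame {y z : N} (hz : z ∈ (extChartAt (𝓡 n) y).source)
    (u : TangentSpace (𝓡 n) y) : constField u z = frame y z (coframe y y u) := by
  rw [← trivializationAt_snd (mem_extChartAt_source y), ← trivializationAt_symm hz]
  rfl

theorem coframe_eq_mvfderiv {y₀ z : N} (hz : z ∈ (extChartAt (𝓡 n) y₀).source)
    (u : TangentSpace (𝓡 n) z) : coframe y₀ z u = mvfderiv (𝓡 n) (extChartAt (𝓡 n) y₀) z u := by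
  have : IsManifold (𝓡 n) 1 N := IsManifold.of_le (n := ∞) (by simp)
  rw [coframe, TangentBundle.continuousLinearMapAt_trivializationAt (by simpa using hz)]
  rfl

theorem mvfderiv_eq_fderiv {V : Type*} [NormedAddCommGroup V] [NormedSpace ℝ V] {f : N → V}
    {y₀ z : N} (hz : z ∈ (extChartAt (𝓡 n) y₀).source)
    (hf : DifferentiableAt ℝ (f ∘ (extChartAt (𝓡 n) y₀).symm) (extChartAt (𝓡 n) y₀ z))
    (u : TangentSpace (𝓡 n) z) :
    mvfderiv (𝓡 n) f z u
      = fderiv ℝ (f ∘ (extChartAt (𝓡 n) y₀).symm) (extChartAt (𝓡 n) y₀ z) (coframe y₀ z u) := by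
  have : IsManifold (𝓡 n) 1 N := IsManifold.of_le (n := ∞) (by simp)
  have hlocal : f =ᶠ[𝓝 z] (f ∘ (extChartAt (𝓡 n) y₀).symm) ∘ extChartAt (𝓡 n) y₀ := by
    filter_upwards [extChartAt_source_mem_nhds' (I := 𝓡 n) hz] with w hw
    simp only [Function.comp_apply, (extChartAt (𝓡 n) y₀).left_inv hw]
  rw [mvfderiv_congr hlocal, coframe_eq_mvfderiv hz]
  have hchain := mfderiv_comp_apply z hf.mdifferentiableAt
    (mdifferentiableAt_extChartAt (I := 𝓡 n) (by simpa using hz)) u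
  rwa [mfderiv_eq_fderiv] at hchain

end Frames

section ChartMap

variable {m n : ℕ}
  {M : Type*} [TopologicalSpace M] [ChartedSpace (EuclideanSpace ℝ (Fin m)) M]
  {N : Type*} [TopologicalSpace N] [ChartedSpace (EuclideanSpace ℝ (Fin n)) N]

variable (m n) in
/-- The coordinate representation of a map in the preferred charts at `x₀` and `y₀`. -/
def chartMap (φ : M → N) (x₀ : M) (y₀ : N) :
    EuclideanSpace ℝ (Fin m) → EuclideanSpace ℝ (Fin n) :=
  extChartAt (𝓡 n) y₀ ∘ φ ∘ (extChartAt (𝓡 m) x₀).symm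

theorem chartMap_extChartAt (φ : M → N) {x₀ x : M} (y₀ : N)
    (hx : x ∈ (extChartAt (𝓡 m) x₀).source) :
    chartMap m n φ x₀ y₀ (extChartAt (𝓡 m) x₀ x) = extChartAt (𝓡 n) y₀ (φ x) := by
  simp only [chartMap, Function.comp_apply, (extChartAt (𝓡 m) x₀).left_inv hx]

theorem eventually_mem_source_of_continuousAt {φ : M → N} {x₀ x : M} {y₀ : N}
    (hφ : ContinuousAt φ x) (hx : x ∈ (extChartAt (𝓡 m) x₀).source)
    (hy : φ x ∈ (extChartAt (𝓡 n) y₀).source) :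
    ∀ᶠ p in 𝓝 (extChartAt (𝓡 m) x₀ x), p ∈ (extChartAt (𝓡 m) x₀).target ∧
      φ ((extChartAt (𝓡 m) x₀).symm p) ∈ (extChartAt (𝓡 n) y₀).source := by
  have hsymm := continuousAt_extChartAt_symm' (I := 𝓡 m) hx
  rw [ContinuousAt, (extChartAt (𝓡 m) x₀).left_inv hx] at hsymm
  filter_upwards [extChartAt_target_mem_nhds' ((extChartAt (𝓡 m) x₀).map_source hx),
    (hφ.tendsto.comp hsymm).eventually (extChartAt_source_mem_nhds' hy)] with p hp hφp
  exact ⟨hp, hφp⟩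

theorem chartMap_id_eventuallyEq (y : N) :
    chartMap n n (id : N → N) y y =ᶠ[𝓝 (extChartAt (𝓡 n) y y)] id := by
  filter_upwards [extChartAt_target_mem_nhds (I := 𝓡 n) y] with p hp
  exact (extChartAt (𝓡 n) y).right_inv hp

variable [IsManifold (𝓡 m) ∞ M] [IsManifold (𝓡 n) ∞ N]

theorem contDiffAt_chartMap {φ : M → N} {x₀ x : M} {y₀ : N}
    (hφ : ContMDiffAt (𝓡 m) (𝓡 n) ∞ φ x) (hx : x ∈ (extChartAt (𝓡 m) x₀).source)
    (hy : φ x ∈ (extChartAt (𝓡 n) y₀).source) :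
    ContDiffAt ℝ ∞ (chartMap m n φ x₀ y₀) (extChartAt (𝓡 m) x₀ x) := by
  rw [← contMDiffAt_iff_contDiffAt]
  have hsymm : ContMDiffAt 𝓘(ℝ, EuclideanSpace ℝ (Fin m)) (𝓡 m) ∞ (extChartAt (𝓡 m) x₀).symm
      (extChartAt (𝓡 m) x₀ x) :=
    (contMDiffOn_extChartAt_symm x₀).contMDiffAt
      (extChartAt_target_mem_nhds' ((extChartAt (𝓡 m) x₀).map_source hx))
  have hchart : ContMDiffAt (𝓡 n) 𝓘(ℝ, EuclideanSpace ℝ (Fin n)) ∞ (extChartAt (𝓡 n) y₀) (φ x) :=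
    contMDiffAt_extChartAt' (by simpa using hy)
  exact ContMDiffAt.comp_of_eq (g := extChartAt (𝓡 n) y₀ ∘ φ) (I' := 𝓡 m) (hchart.comp x hφ) hsymm
    ((extChartAt (𝓡 m) x₀).left_inv hx)

theorem coframe_mfderiv {φ : M → N} {x₀ x : M} {y₀ : N}
    (hφ : ContMDiffAt (𝓡 m) (𝓡 n) ∞ φ x) (hx : x ∈ (extChartAt (𝓡 m) x₀).source)
    (hy : φ x ∈ (extChartAt (𝓡 n) y₀).source) (u : TangentSpace (𝓡 m) x) :
    coframe y₀ (φ x) (mfderiv (𝓡 m) (𝓡 n) φ x u)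
      = fderiv ℝ (chartMap m n φ x₀ y₀) (extChartAt (𝓡 m) x₀ x) (coframe x₀ x u) := by
  have : IsManifold (𝓡 n) 1 N := IsManifold.of_le (n := ∞) (by simp)
  have hchain := mfderiv_comp_apply x
    (mdifferentiableAt_extChartAt (I := 𝓡 n) (x := y₀) (by simpa using hy))
    (hφ.mdifferentiableAt (by simp)) u
  rw [coframe_eq_mvfderiv hy]
  refine Eq.trans hchain.symm ?_
  exact mvfderiv_eq_fderiv (f := extChartAt (𝓡 n) y₀ ∘ φ) hx
    ((contDiffAt_chartMap hφ hx hy).differentiableAt (by simp)) u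

theorem coframe_change {x₀ x₁ x : M} (hx₀ : x ∈ (extChartAt (𝓡 m) x₀).source)
    (hx₁ : x ∈ (extChartAt (𝓡 m) x₁).source) (u : TangentSpace (𝓡 m) x) :
    fderiv ℝ (chartMap m m (id : M → M) x₀ x₁) (extChartAt (𝓡 m) x₀ x) (coframe x₀ x u)
      = coframe x₁ x u := by
  have h := coframe_mfderiv (φ := (id : M → M)) (x := x) contMDiffAt_id hx₀ hx₁ u
  rw [mfderiv_id] at h
  exact h.symm

end ChartMap

section ChartMetric

variable {n : ℕ} {N : Type*} [TopologicalSpace N] [ChartedSpace (EuclideanSpace ℝ (Fin n)) N]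
  [IsManifold (𝓡 n) ∞ N] [RiemannianBundle (fun y : N ↦ TangentSpace (𝓡 n) y)]

/-- The metric in the preferred chart at `y₀`, as a function on the model space. -/
def chartMetric (y₀ : N) (p : EuclideanSpace ℝ (Fin n)) :
    EuclideanSpace ℝ (Fin n) →L[ℝ] EuclideanSpace ℝ (Fin n) →L[ℝ] ℝ :=
  (innerSL ℝ (E := TangentSpace (𝓡 n) ((extChartAt (𝓡 n) y₀).symm p))).bilinearComp
    (frame y₀ ((extChartAt (𝓡 n) y₀).symm p)) (frame y₀ ((extChartAt (𝓡 n) y₀).symm p))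

theorem chartMetric_apply (y₀ : N) (p u w : EuclideanSpace ℝ (Fin n)) :
    chartMetric y₀ p u w = inner ℝ (frame y₀ ((extChartAt (𝓡 n) y₀).symm p) u)
      (frame y₀ ((extChartAt (𝓡 n) y₀).symm p) w) := rfl

theorem chartMetric_extChartAt {y₀ z : N} (hz : z ∈ (extChartAt (𝓡 n) y₀).source)
    (u w : EuclideanSpace ℝ (Fin n)) :
    chartMetric y₀ (extChartAt (𝓡 n) y₀ z) u w = inner ℝ (frame y₀ z u) (frame y₀ z w) := by
  rw [chartMetric_apply, (extChartAt (𝓡 n) y₀).left_inv hz]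

theorem chartMetric_coframe {y₀ z : N} (hz : z ∈ (extChartAt (𝓡 n) y₀).source)
    (u w : TangentSpace (𝓡 n) z) :
    chartMetric y₀ (extChartAt (𝓡 n) y₀ z) (coframe y₀ z u) (coframe y₀ z w) = inner ℝ u w := by
  rw [chartMetric_extChartAt hz, frame_coframe hz, frame_coframe hz]

theorem chartMetric_coframe_onb {y₀ z : N} (hz : z ∈ (extChartAt (𝓡 n) y₀).source) (i j : Fin n) :
    chartMetric y₀ (extChartAt (𝓡 n) y₀ z) (coframe y₀ z (onb n z i)) (coframe y₀ z (onb n z j))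
      = if i = j then 1 else 0 := by
  rw [chartMetric_coframe hz]
  exact orthonormal_iff_ite.mp (onb n z).orthonormal i j

theorem chartMetric_symm (y₀ : N) (p u w : EuclideanSpace ℝ (Fin n)) :
    chartMetric y₀ p u w = chartMetric y₀ p w u := by
  rw [chartMetric_apply, chartMetric_apply, real_inner_comm]

theorem isInvertible_chartMetric {y₀ : N} {p : EuclideanSpace ℝ (Fin n)}
    (hp : p ∈ (extChartAt (𝓡 n) y₀).target) : (chartMetric y₀ p).IsInvertible := by
  refine isInvertible_of_pos fun u hu ↦ ?_
  have hframe : frame y₀ ((extChartAt (𝓡 n) y₀).symm p) u ≠ 0 := fun h ↦ hu <| by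
    rw [← coframe_frame ((extChartAt (𝓡 n) y₀).map_target hp) u, h, map_zero]
  rw [chartMetric_apply, real_inner_self_eq_norm_sq]
  positivity

variable [IsContMDiffRiemannianBundle (𝓡 n) ∞ (EuclideanSpace ℝ (Fin n))
      (fun y : N ↦ TangentSpace (𝓡 n) y)]

theorem contMDiffAt_inner_frame {y₀ z : N} (hz : z ∈ (extChartAt (𝓡 n) y₀).source)
    (u w : EuclideanSpace ℝ (Fin n)) :
    ContMDiffAt (𝓡 n) 𝓘(ℝ, ℝ) ∞ (fun z ↦ (inner ℝ (frame y₀ z u) (frame y₀ z w) : ℝ)) z := by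
  have hframe (v : EuclideanSpace ℝ (Fin n)) :
      ContMDiffAt (𝓡 n) ((𝓡 n).prod 𝓘(ℝ, EuclideanSpace ℝ (Fin n))) ∞
        (fun z ↦ (⟨z, frame y₀ z v⟩ : TangentBundle (𝓡 n) N)) z := by
    rw [Trivialization.contMDiffAt_section_iff (trivializationAt (EuclideanSpace ℝ (Fin n))
      (TangentSpace (𝓡 n) : N → Type _) y₀) (mem_baseSet_of_mem_source hz)]
    refine (contMDiffAt_const (c := v)).congr_of_eventuallyEq ?_
    filter_upwards [extChartAt_source_mem_nhds' (I := 𝓡 n) hz] with z' hz'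
    rw [trivializationAt_snd hz', coframe_frame hz']
  exact (hframe u).inner_bundle (hframe w)

theorem contDiffAt_chartMetric {y₀ : N} {p : EuclideanSpace ℝ (Fin n)}
    (hp : p ∈ (extChartAt (𝓡 n) y₀).target) : ContDiffAt ℝ ∞ (chartMetric y₀) p := by
  have hopen : IsOpen (extChartAt (𝓡 n) y₀).target := isOpen_extChartAt_target y₀
  refine ContDiffOn.contDiffAt ?_ (hopen.mem_nhds hp)
  rw [contDiffOn_clm_apply]
  intro u
  rw [contDiffOn_clm_apply]
  intro w q hq
  refine (contMDiffAt_iff_contDiffAt.1 ?_).contDiffWithinAt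
  exact (contMDiffAt_inner_frame ((extChartAt (𝓡 n) y₀).map_target hq) u w).comp q
    ((contMDiffOn_extChartAt_symm y₀).contMDiffAt (hopen.mem_nhds hq))

end ChartMetric

section CovariantDerivative

variable {n : ℕ} {N : Type*} [TopologicalSpace N] [ChartedSpace (EuclideanSpace ℝ (Fin n)) N]
  [IsManifold (𝓡 n) ∞ N] [RiemannianBundle (fun y : N ↦ TangentSpace (𝓡 n) y)]
  [IsContMDiffRiemannianBundle (𝓡 n) ∞ (EuclideanSpace ℝ (Fin n))
      (fun y : N ↦ TangentSpace (𝓡 n) y)]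

theorem derivInner_constField {y : N} (u w e : TangentSpace (𝓡 n) y) :
    derivInner (constField u) (constField w) e
      = fderiv ℝ (chartMetric y) (extChartAt (𝓡 n) y y) (coframe y y e) (coframe y y u)
          (coframe y y w) := by
  have hmetric : DifferentiableAt ℝ (chartMetric y) (extChartAt (𝓡 n) y y) :=
    (contDiffAt_chartMetric (mem_extChartAt_target y)).differentiableAt (by simp)
  have hlocal : ((fun z : N ↦ (inner ℝ (constField u z) (constField w z) : ℝ)) ∘
      (extChartAt (𝓡 n) y).symm) =ᶠ[𝓝 (extChartAt (𝓡 n) y y)]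
      fun p ↦ chartMetric y p (coframe y y u) (coframe y y w) := by
    filter_upwards [extChartAt_target_mem_nhds (I := 𝓡 n) y] with p hp
    simp only [Function.comp_apply, chartMetric_apply,
      constField_eq_frame ((extChartAt (𝓡 n) y).map_target hp)]
  have hderiv := ((hmetric.hasFDerivAt.clm_apply (hasFDerivAt_const (coframe y y u) _)).clm_apply
    (hasFDerivAt_const (coframe y y w) _)).congr_of_eventuallyEq hlocal
  rw [derivInner, mvfderiv_eq_fderiv (mem_extChartAt_source y) hderiv.differentiableAt,
    hderiv.fderiv]
  simp

theorem coframe_christoffel (y : N) (u w : TangentSpace (𝓡 n) y) :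
    coframe y y (christoffel y u w)
      = christoffelSecond (chartMetric y) (extChartAt (𝓡 n) y y) (coframe y y u)
          (coframe y y w) := by
  have hy := mem_extChartAt_source (I := 𝓡 n) y
  suffices h : frame y y (christoffelSecond (chartMetric y) (extChartAt (𝓡 n) y y)
      (coframe y y u) (coframe y y w)) = christoffel y u w by rw [← h, coframe_frame hy]
  rw [← (onb n y).sum_repr' (frame y y _), christoffel]
  refine Finset.sum_congr rfl fun a _ ↦ ?_
  rw [real_inner_comm, ← chartMetric_coframe hy, coframe_frame hy,
    metric_christoffelSecond (isInvertible_chartMetric (mem_extChartAt_target y)),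
    derivInner_constField, derivInner_constField, derivInner_constField]

variable {m : ℕ} {M : Type*} [TopologicalSpace M] [ChartedSpace (EuclideanSpace ℝ (Fin m)) M]
  [IsManifold (𝓡 m) ∞ M]

theorem coframe_covAlong {φ : M → N} {x : M} (hφ : ContMDiffAt (𝓡 m) (𝓡 n) ∞ φ x)
    (W : Π x : M, TangentSpace (𝓡 n) (φ x)) (v : TangentSpace (𝓡 m) x)
    (hW : DifferentiableAt ℝ (localRep φ W x ∘ (extChartAt (𝓡 m) x).symm)
      (extChartAt (𝓡 m) x x)) :
    coframe (φ x) (φ x) (covAlong φ W x v)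
      = fderiv ℝ (localRep φ W x ∘ (extChartAt (𝓡 m) x).symm) (extChartAt (𝓡 m) x x)
          (coframe x x v)
        + christoffelSecond (chartMetric (φ x)) (extChartAt (𝓡 n) (φ x) (φ x))
          (fderiv ℝ (chartMap m n φ x (φ x)) (extChartAt (𝓡 m) x x) (coframe x x v))
          (coframe (φ x) (φ x) (W x)) := by
  have hx := mem_extChartAt_source (I := 𝓡 m) x
  have hy := mem_extChartAt_source (I := 𝓡 n) (φ x)
  rw [covAlong, map_add, coframe_christoffel, coframe_mfderiv hφ hx hy,
    mvfderiv_eq_fderiv hx hW, trivializationAt_symm hy]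
  congr 1
  exact coframe_frame hy _

theorem coframe_covAlong_pushField [RiemannianBundle (fun x : M ↦ TangentSpace (𝓡 m) x)]
    {φ : M → N} (hφ : ContMDiff (𝓡 m) (𝓡 n) ∞ φ) {x : M} (e v : TangentSpace (𝓡 m) x) :
    coframe (φ x) (φ x) (covAlong φ (pushField m n φ (constField e)) x v)
      = fderiv ℝ (fderiv ℝ (chartMap m n φ x (φ x))) (extChartAt (𝓡 m) x x) (coframe x x v)
          (coframe x x e)
        + christoffelSecond (chartMetric (φ x)) (extChartAt (𝓡 n) (φ x) (φ x))
          (fderiv ℝ (chartMap m n φ x (φ x)) (extChartAt (𝓡 m) x x) (coframe x x v))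
          (fderiv ℝ (chartMap m n φ x (φ x)) (extChartAt (𝓡 m) x x) (coframe x x e)) := by
  have hx := mem_extChartAt_source (I := 𝓡 m) x
  have hy := mem_extChartAt_source (I := 𝓡 n) (φ x)
  have hlocal : (localRep φ (pushField m n φ (constField e)) x ∘ (extChartAt (𝓡 m) x).symm)
      =ᶠ[𝓝 (extChartAt (𝓡 m) x x)]
      fun p ↦ fderiv ℝ (chartMap m n φ x (φ x)) p (coframe x x e) := by
    filter_upwards [eventually_mem_source_of_continuousAt hφ.continuous.continuousAt hx hy]
      with p ⟨hp, hφp⟩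
    have hsource := (extChartAt (𝓡 m) x).map_target hp
    simp only [Function.comp_apply, localRep, pushField]
    rw [trivializationAt_snd hφp, coframe_mfderiv hφ.contMDiffAt hsource hφp,
      constField_eq_frame hsource, coframe_frame hsource, (extChartAt (𝓡 m) x).right_inv hp]
  have hD : DifferentiableAt ℝ (fderiv ℝ (chartMap m n φ x (φ x))) (extChartAt (𝓡 m) x x) :=
    ((contDiffAt_chartMap hφ.contMDiffAt hx hy).fderiv_right (m := ∞) (by simp)).differentiableAt
      (by simp)
  have hderiv := (hD.hasFDerivAt.clm_apply
    (hasFDerivAt_const (coframe x x e) _)).congr_of_eventuallyEq hlocal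
  rw [coframe_covAlong hφ.contMDiffAt _ _ hderiv.differentiableAt, hderiv.fderiv, pushField,
    constField_eq_frame hx, frame_coframe hx, coframe_mfderiv hφ.contMDiffAt hx hy]
  simp

theorem coframe_nabla_constField {y : N} (e v : TangentSpace (𝓡 n) y) :
    coframe y y (nabla (constField e) y v)
      = christoffelSecond (chartMetric y) (extChartAt (𝓡 n) y y) (coframe y y v)
          (coframe y y e) := by
  have hy := mem_extChartAt_source (I := 𝓡 n) y
  have hpush : pushField n n (id : N → N) (constField e) = constField e := by
    funext z
    rw [pushField, mfderiv_id]
    rfl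
  have hsecond :
      fderiv ℝ (fderiv ℝ (chartMap n n (id : N → N) y y)) (extChartAt (𝓡 n) y y) = 0 := by
    have hid : fderiv ℝ (id : EuclideanSpace ℝ (Fin n) → _) = fun _ ↦ .id ℝ _ := by
      funext p
      exact fderiv_id
    rw [(chartMap_id_eventuallyEq y).fderiv.fderiv_eq, hid, fderiv_const_apply]
  have h := coframe_covAlong_pushField (φ := (id : N → N)) contMDiff_id (x := y) e v
  rw [hpush] at h
  refine h.trans ?_
  simp only [id_eq, hsecond, coframe_change hy hy, zero_apply, zero_add]

end CovariantDerivative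

section Tension

variable {m : ℕ} {M : Type*} [TopologicalSpace M] [ChartedSpace (EuclideanSpace ℝ (Fin m)) M]
  [RiemannianBundle (fun x : M ↦ TangentSpace (𝓡 m) x)]

theorem isIsometricImmersion_id : IsIsometricImmersion m m (id : M → M) where
  smooth := contMDiff_id
  isometric x u v := by
    rw [mfderiv_id]
    rfl

variable {n : ℕ} [IsManifold (𝓡 m) ∞ M]
  {N : Type*} [TopologicalSpace N] [ChartedSpace (EuclideanSpace ℝ (Fin n)) N]
  [IsManifold (𝓡 n) ∞ N] [RiemannianBundle (fun y : N ↦ TangentSpace (𝓡 n) y)]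

variable (m n) in
/-- The covariant Hessian `∇dφ` in the preferred charts at `x₀` and `y₀`. -/
def chartHess (φ : M → N) (x₀ : M) (y₀ : N) (p : EuclideanSpace ℝ (Fin m)) :
    EuclideanSpace ℝ (Fin m) →L[ℝ] EuclideanSpace ℝ (Fin m) →L[ℝ] EuclideanSpace ℝ (Fin n) :=
  covHess (chartMetric x₀) (chartMetric y₀) (chartMap m n φ x₀ y₀) p

theorem chartMetric_pullback {φ : M → N} (hφ : IsIsometricImmersion m n φ) {x₀ x : M} {y₀ : N}
    (hx : x ∈ (extChartAt (𝓡 m) x₀).source) (hy : φ x ∈ (extChartAt (𝓡 n) y₀).source)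
    (u w : EuclideanSpace ℝ (Fin m)) :
    chartMetric x₀ (extChartAt (𝓡 m) x₀ x) u w
      = chartMetric y₀ (chartMap m n φ x₀ y₀ (extChartAt (𝓡 m) x₀ x))
          (fderiv ℝ (chartMap m n φ x₀ y₀) (extChartAt (𝓡 m) x₀ x) u)
          (fderiv ℝ (chartMap m n φ x₀ y₀) (extChartAt (𝓡 m) x₀ x) w) := by
  have hpush := coframe_mfderiv hφ.smooth.contMDiffAt hx hy
  rw [chartMetric_extChartAt hx, ← hφ.isometric, chartMap_extChartAt _ _ hx,
    ← chartMetric_coframe hy, hpush, hpush, coframe_frame hx, coframe_frame hx]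

variable [IsContMDiffRiemannianBundle (𝓡 m) ∞ (EuclideanSpace ℝ (Fin m))
      (fun x : M ↦ TangentSpace (𝓡 m) x)]
  [IsContMDiffRiemannianBundle (𝓡 n) ∞ (EuclideanSpace ℝ (Fin n))
      (fun y : N ↦ TangentSpace (𝓡 n) y)]

theorem coframe_secondDerivative {φ : M → N} {x : M} (hφ : ContMDiff (𝓡 m) (𝓡 n) ∞ φ)
    (e v : TangentSpace (𝓡 m) x) :
    coframe (φ x) (φ x) (covAlong φ (pushField m n φ (constField e)) x v
        - mfderiv (𝓡 m) (𝓡 n) φ x (nabla (constField e) x v))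
      = chartHess m n φ x (φ x) (extChartAt (𝓡 m) x x) (coframe x x v) (coframe x x e) := by
  have hx := mem_extChartAt_source (I := 𝓡 m) x
  have hy := mem_extChartAt_source (I := 𝓡 n) (φ x)
  rw [map_sub, coframe_covAlong_pushField hφ, coframe_mfderiv hφ.contMDiffAt hx hy,
    coframe_nabla_constField, chartHess, covHess_apply, chartMap_extChartAt _ _ hx]

theorem coframe_tension_self {φ : M → N} {x : M} (hφ : ContMDiff (𝓡 m) (𝓡 n) ∞ φ) :
    coframe (φ x) (φ x) (tension m n φ x)
      = ∑ i, chartHess m n φ x (φ x) (extChartAt (𝓡 m) x x) (coframe x x (onb m x i))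
          (coframe x x (onb m x i)) := by
  rw [tension, map_sum]
  exact Finset.sum_congr rfl fun i _ ↦ coframe_secondDerivative hφ _ _

theorem chartHess_normal {φ : M → N} (hφ : IsIsometricImmersion m n φ) {x₀ x : M} {y₀ : N}
    (hx : x ∈ (extChartAt (𝓡 m) x₀).source) (hy : φ x ∈ (extChartAt (𝓡 n) y₀).source)
    (u w e : EuclideanSpace ℝ (Fin m)) :
    chartMetric y₀ (extChartAt (𝓡 n) y₀ (φ x))
      (chartHess m n φ x₀ y₀ (extChartAt (𝓡 m) x₀ x) u w)
      (fderiv ℝ (chartMap m n φ x₀ y₀) (extChartAt (𝓡 m) x₀ x) e) = 0 := by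
  have hp := (extChartAt (𝓡 m) x₀).map_source hx
  have hq := (extChartAt (𝓡 n) y₀).map_source hy
  rw [← chartMap_extChartAt (m := m) φ y₀ hx] at hq ⊢
  refine covHess_normal
    ((contDiffAt_chartMap hφ.smooth.contMDiffAt hx hy).of_le ENat.LEInfty.out)
    ((contDiffAt_chartMetric hp).differentiableAt (by simp))
    ((contDiffAt_chartMetric hq).differentiableAt (by simp))
    (isInvertible_chartMetric hp) (isInvertible_chartMetric hq) (chartMetric_symm y₀ _) ?_ u w e
  filter_upwards [eventually_mem_source_of_continuousAt hφ.smooth.continuous.continuousAt hx hy]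
    with p ⟨hp, hφp⟩
  have hpull := chartMetric_pullback hφ ((extChartAt (𝓡 m) x₀).map_target hp) hφp
  rwa [(extChartAt (𝓡 m) x₀).right_inv hp] at hpull

theorem chartHess_id {x₀ x₁ x : M} (hx₀ : x ∈ (extChartAt (𝓡 m) x₀).source)
    (hx₁ : x ∈ (extChartAt (𝓡 m) x₁).source) :
    chartHess m m (id : M → M) x₀ x₁ (extChartAt (𝓡 m) x₀ x) = 0 := by
  ext1 u
  ext1 w
  refine (isInvertible_chartMetric ((extChartAt (𝓡 m) x₁).map_source hx₁)).injective ?_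
  rw [zero_apply, zero_apply, map_zero]
  ext1 e
  have hnormal := chartHess_normal isIsometricImmersion_id hx₀ hx₁ u w
    (coframe x₀ x (frame x₁ x e))
  rwa [coframe_change hx₀ hx₁, coframe_frame hx₁] at hnormal

theorem chartHess_change {φ : M → N} (hφ : ContMDiff (𝓡 m) (𝓡 n) ∞ φ) {x₀ x₁ x : M} {y₀ y₁ : N}
    (hx₀ : x ∈ (extChartAt (𝓡 m) x₀).source) (hx₁ : x ∈ (extChartAt (𝓡 m) x₁).source)
    (hy₀ : φ x ∈ (extChartAt (𝓡 n) y₀).source) (hy₁ : φ x ∈ (extChartAt (𝓡 n) y₁).source)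
    (u w : EuclideanSpace ℝ (Fin m)) :
    fderiv ℝ (chartMap n n (id : N → N) y₀ y₁) (extChartAt (𝓡 n) y₀ (φ x))
        (chartHess m n φ x₀ y₀ (extChartAt (𝓡 m) x₀ x) u w)
      = chartHess m n φ x₁ y₁ (extChartAt (𝓡 m) x₁ x)
          (fderiv ℝ (chartMap m m (id : M → M) x₀ x₁) (extChartAt (𝓡 m) x₀ x) u)
          (fderiv ℝ (chartMap m m (id : M → M) x₀ x₁) (extChartAt (𝓡 m) x₀ x) w) := by
  have hψ := (contDiffAt_chartMap hφ.contMDiffAt hx₀ hy₀).of_le (m := 2) ENat.LEInfty.out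
  have hψ' := (contDiffAt_chartMap hφ.contMDiffAt hx₁ hy₁).of_le (m := 2) ENat.LEInfty.out
  have hθ := (contDiffAt_chartMap contMDiffAt_id hx₀ hx₁).of_le (m := 2) ENat.LEInfty.out
  have hκ := (contDiffAt_chartMap contMDiffAt_id hy₀ hy₁).of_le (m := 2) ENat.LEInfty.out
  have hcomm : chartMap n n (id : N → N) y₀ y₁ ∘ chartMap m n φ x₀ y₀
      =ᶠ[𝓝 (extChartAt (𝓡 m) x₀ x)] chartMap m n φ x₁ y₁ ∘ chartMap m m (id : M → M) x₀ x₁ := by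
    filter_upwards [eventually_mem_source_of_continuousAt hφ.continuous.continuousAt hx₀ hy₀,
      eventually_mem_source_of_continuousAt (φ := (id : M → M)) continuousAt_id hx₀ hx₁]
      with p ⟨_, hφp⟩ ⟨_, hp⟩
    simp only [chartMap, Function.comp_apply, id, (extChartAt (𝓡 n) y₀).left_inv hφp,
      (extChartAt (𝓡 m) x₁).left_inv (id_eq _ ▸ hp)]
  have hθ_affine := chartHess_id hx₀ hx₁
  have hκ_affine := chartHess_id hy₀ hy₁
  rw [← chartMap_extChartAt (m := m) φ y₀ hx₀] at hκ hκ_affine ⊢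
  have hθ_apply : chartMap m m (id : M → M) x₀ x₁ (extChartAt (𝓡 m) x₀ x)
      = extChartAt (𝓡 m) x₁ x := chartMap_extChartAt _ _ hx₀
  rw [← hθ_apply] at hψ' ⊢
  exact covHess_natural hψ hψ' hθ hκ hθ_affine hκ_affine hcomm u w

theorem coframe_tension {φ : M → N} (hφ : ContMDiff (𝓡 m) (𝓡 n) ∞ φ) {x₀ x : M} {y₀ : N}
    (hx : x ∈ (extChartAt (𝓡 m) x₀).source) (hy : φ x ∈ (extChartAt (𝓡 n) y₀).source) :
    coframe y₀ (φ x) (tension m n φ x)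
      = metricTrace (chartMetric x₀ (extChartAt (𝓡 m) x₀ x))
          (chartHess m n φ x₀ y₀ (extChartAt (𝓡 m) x₀ x)) := by
  have hx_self := mem_extChartAt_source (I := 𝓡 m) x
  have hy_self := mem_extChartAt_source (I := 𝓡 n) (φ x)
  rw [← coframe_change hy_self hy, coframe_tension_self hφ, map_sum,
    metricTrace_eq_sum (isInvertible_chartMetric ((extChartAt (𝓡 m) x₀).map_source hx)) _
      (by simp) (chartMetric_coframe_onb hx)]
  refine Finset.sum_congr rfl fun i _ ↦ ?_
  rw [chartHess_change hφ hx_self hx hy_self hy, coframe_change hx_self hx]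

theorem normSq_tension {φ : M → N} (hφ : ContMDiff (𝓡 m) (𝓡 n) ∞ φ) {x₀ x : M} {y₀ : N}
    (hx : x ∈ (extChartAt (𝓡 m) x₀).source) (hy : φ x ∈ (extChartAt (𝓡 n) y₀).source) :
    ‖tension m n φ x‖ ^ 2
      = chartMetric y₀ (extChartAt (𝓡 n) y₀ (φ x))
          (metricTrace (chartMetric x₀ (extChartAt (𝓡 m) x₀ x))
            (chartHess m n φ x₀ y₀ (extChartAt (𝓡 m) x₀ x)))
          (metricTrace (chartMetric x₀ (extChartAt (𝓡 m) x₀ x))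
            (chartHess m n φ x₀ y₀ (extChartAt (𝓡 m) x₀ x))) := by
  rw [← coframe_tension hφ hx hy, chartMetric_coframe hy, real_inner_self_eq_norm_sq]

end Tension

section Minimal

variable {m n : ℕ}
  {M : Type*} [TopologicalSpace M] [ChartedSpace (EuclideanSpace ℝ (Fin m)) M]
  [IsManifold (𝓡 m) ∞ M] [RiemannianBundle (fun x : M ↦ TangentSpace (𝓡 m) x)]
  {N : Type*} [TopologicalSpace N] [ChartedSpace (EuclideanSpace ℝ (Fin n)) N]
  [IsManifold (𝓡 n) ∞ N] [RiemannianBundle (fun y : N ↦ TangentSpace (𝓡 n) y)]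

variable (m n) in
/-- A map between Riemannian manifolds is harmonic if its tension field vanishes identically. For
isometric immersions this is minimality. -/
def IsHarmonic (φ : M → N) : Prop := ∀ x, tension m n φ x = 0

variable [IsContMDiffRiemannianBundle (𝓡 m) ∞ (EuclideanSpace ℝ (Fin m))
      (fun x : M ↦ TangentSpace (𝓡 m) x)]
  [IsContMDiffRiemannianBundle (𝓡 n) ∞ (EuclideanSpace ℝ (Fin n))
      (fun y : N ↦ TangentSpace (𝓡 n) y)]

theorem tension_mem_normalSpace {φ : M → N} (hφ : IsIsometricImmersion m n φ) (x : M) :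
    tension m n φ x ∈ normalSpace m n φ x := by
  have hx := mem_extChartAt_source (I := 𝓡 m) x
  have hy := mem_extChartAt_source (I := 𝓡 n) (φ x)
  rw [normalSpace, Submodule.mem_orthogonal]
  rintro _ ⟨u, rfl⟩
  rw [real_inner_comm, ContinuousLinearMap.coe_coe, ← chartMetric_coframe hy,
    coframe_tension_self hφ.smooth, coframe_mfderiv hφ.smooth.contMDiffAt hx hy, map_sum,
    sum_apply]
  exact Finset.sum_eq_zero fun i _ ↦ chartHess_normal hφ hx hy _ _ _

theorem meanCurvature_eq_tension {φ : M → N} (hφ : IsIsometricImmersion m n φ) (x : M) :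
    meanCurvature m n φ x = (m : ℝ)⁻¹ • tension m n φ x := by
  have htangent (u : TangentSpace (𝓡 m) x) :
      (normalSpace m n φ x).starProjection (mfderiv (𝓡 m) (𝓡 n) φ x u) = 0 := by
    rw [Submodule.starProjection_apply_eq_zero_iff, normalSpace]
    exact Submodule.le_orthogonal_orthogonal _ ⟨u, rfl⟩
  rw [meanCurvature, ← Submodule.starProjection_eq_self_iff.mpr (tension_mem_normalSpace hφ x),
    tension, map_sum]
  congr 1
  refine Finset.sum_congr rfl fun i _ ↦ ?_
  rw [map_sub, htangent, sub_zero]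
  rfl

theorem isMinimal_iff_isHarmonic {φ : M → N} (hφ : IsIsometricImmersion m n φ) :
    IsMinimal m n φ ↔ IsHarmonic m n φ := by
  refine forall_congr' fun x ↦ ?_
  rw [meanCurvature_eq_tension hφ]
  rcases eq_or_ne m 0 with rfl | hm
  · simp [tension]
  · simp [hm]

end Minimal

section FBitension

variable {m n : ℕ}
  {M : Type*} [TopologicalSpace M] [ChartedSpace (EuclideanSpace ℝ (Fin m)) M]
  {N : Type*} [TopologicalSpace N] [ChartedSpace (EuclideanSpace ℝ (Fin n)) N]
  [IsManifold (𝓡 n) ∞ N]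

theorem constField_zero_eventually (y : N) :
    constField (0 : TangentSpace (𝓡 n) y) =ᶠ[𝓝 y] 0 := by
  filter_upwards [extChartAt_source_mem_nhds (I := 𝓡 n) y] with z hz
  rw [constField_eq_frame hz, map_zero, map_zero]
  rfl

variable [RiemannianBundle (fun y : N ↦ TangentSpace (𝓡 n) y)]
  [IsContMDiffRiemannianBundle (𝓡 n) ∞ (EuclideanSpace ℝ (Fin n))
      (fun y : N ↦ TangentSpace (𝓡 n) y)]

theorem covAlong_eq_zero {φ : M → N} {x : M} (hφ : ContinuousAt φ x)
    {W : Π x : M, TangentSpace (𝓡 n) (φ x)} (hW : ∀ᶠ x' in 𝓝 x, W x' = 0)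
    (v : TangentSpace (𝓡 m) x) : covAlong φ W x v = 0 := by
  have hlocal : localRep φ W x =ᶠ[𝓝 x] fun _ ↦ 0 := by
    filter_upwards [hW, hφ.eventually (extChartAt_source_mem_nhds (I := 𝓡 n) (φ x))]
      with x' hWx hx'
    rw [localRep, trivializationAt_snd hx', hWx, map_zero]
  have hy := mem_extChartAt_source (I := 𝓡 n) (φ x)
  rw [← coframe_eq_zero_iff hy, covAlong, map_add, coframe_christoffel, hW.self_of_nhds,
    mvfderiv_congr hlocal, mvfderiv_const, trivializationAt_symm hy]
  simp

theorem covAlong_zero_right (φ : M → N) (W : Π x : M, TangentSpace (𝓡 n) (φ x)) (x : M) :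
    covAlong φ W x (0 : TangentSpace (𝓡 m) x) = 0 := by
  have hy := mem_extChartAt_source (I := 𝓡 n) (φ x)
  rw [← coframe_eq_zero_iff hy, covAlong, map_add, coframe_christoffel, trivializationAt_symm hy]
  simp

theorem curvature_zero_middle (y : N) (u w : TangentSpace (𝓡 n) y) : curvature y u 0 w = 0 := by
  have hnabla : nabla (fun z ↦ nabla (constField w) z (constField (0 : TangentSpace (𝓡 n) y) z)) y u
      = 0 := by
    refine covAlong_eq_zero (φ := (id : N → N)) continuousAt_id ?_ u
    filter_upwards [constField_zero_eventually (n := n) y] with z hz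
    rw [hz]
    exact covAlong_zero_right (m := n) (id : N → N) _ z
  have hbracket : VectorField.mlieBracket (𝓡 n) (constField u)
      (constField (0 : TangentSpace (𝓡 n) y)) y = 0 :=
    (Filter.EventuallyEq.mlieBracket_vectorField_eq (I := 𝓡 n) (V := constField u)
      EventuallyEq.rfl (constField_zero_eventually y)).trans
      (congrFun (VectorField.mlieBracket_zero_right (I := 𝓡 n) (W := constField u)) y)
  have hnabla_zero (X : Π z : N, TangentSpace (𝓡 n) z) : nabla X y 0 = 0 :=
    covAlong_zero_right (m := n) (id : N → N) X y
  rw [curvature, hnabla, hbracket, hnabla_zero, hnabla_zero]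
  simp

variable [IsManifold (𝓡 m) ∞ M] [RiemannianBundle (fun x : M ↦ TangentSpace (𝓡 m) x)]

theorem fBitension_eq_zero_of_isHarmonic {φ : M → N} (hφ : Continuous φ)
    (hharm : IsHarmonic m n φ) (f : M → ℝ) (x : M) : fBitension m n φ f x = 0 := by
  have hcov (z : M) (v : TangentSpace (𝓡 m) z) : covAlong φ (tension m n φ) z v = 0 :=
    covAlong_eq_zero hφ.continuousAt (Eventually.of_forall hharm) v
  have hbitension : bitension m n φ x = 0 := by
    rw [bitension, roughLaplacian, hharm x]
    simp only [curvature_zero_middle, hcov, sub_zero, Finset.sum_const_zero]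
    exact Finset.sum_eq_zero fun i _ ↦
      covAlong_eq_zero hφ.continuousAt (Eventually.of_forall fun _ ↦ rfl) _
  rw [fBitension, hbitension, hharm x, hcov, smul_zero, smul_zero, smul_zero, add_zero, add_zero]

theorem fBitension_of_mvfderiv_eq_zero (φ : M → N) {f : M → ℝ} {x : M}
    (hf : ∀ u, mvfderiv (𝓡 m) f x u = 0) :
    fBitension m n φ f x = f x • bitension m n φ x + laplacian m f x • tension m n φ x := by
  have hgrad : grad m f x = 0 := by simp only [grad, hf, zero_smul, Finset.sum_const_zero]
  rw [fBitension, hgrad, covAlong_zero_right, smul_zero, add_zero]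

end FBitension

section QuadraticBump

theorem fderiv_norm_sub_sq_smul {E F : Type*} [NormedAddCommGroup E] [InnerProductSpace ℝ E]
    [NormedAddCommGroup F] [NormedSpace ℝ F] (p₀ p : E) (v : F) :
    fderiv ℝ (fun q ↦ ‖q - p₀‖ ^ 2 • v) p = ((2 : ℝ) • innerSL ℝ (p - p₀)).smulRight v := by
  have hnorm := ((hasFDerivAt_id p).sub_const p₀).norm_sq
  rw [← ofNat_smul_eq_nsmul ℝ 2] at hnorm
  exact (hnorm.smul_const v).fderiv

theorem fderiv_fderiv_norm_sub_sq_smul {E F : Type*} [NormedAddCommGroup E]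
    [InnerProductSpace ℝ E] [NormedAddCommGroup F] [NormedSpace ℝ F] (p₀ u w : E) (p : E) (v : F) :
    fderiv ℝ (fderiv ℝ fun q ↦ ‖q - p₀‖ ^ 2 • v) p u w = (2 * inner ℝ u w) • v := by
  have hfderiv : fderiv ℝ (fun q ↦ ‖q - p₀‖ ^ 2 • v) =
      fun p ↦ ((2 : ℝ) • innerSL ℝ (p - p₀)).smulRight v :=
    funext fun p ↦ fderiv_norm_sub_sq_smul p₀ p v
  have hlinear : HasFDerivAt (fun p ↦ (2 : ℝ) • innerSL ℝ (p - p₀)) ((2 : ℝ) • innerSL ℝ) p :=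
    ((innerSL ℝ).hasFDerivAt.comp p ((hasFDerivAt_id p).sub_const p₀)).const_smul (2 : ℝ)
  have hsmulRight := (ContinuousLinearMap.smulRightL ℝ E F).flip v |>.hasFDerivAt.comp p hlinear
  rw [hfderiv]
  exact congrArg (fun L ↦ L u w) hsmulRight.fderiv

variable {m : ℕ} {M : Type*} [TopologicalSpace M]
  [ChartedSpace (EuclideanSpace ℝ (Fin m)) M] [IsManifold (𝓡 m) ∞ M]

theorem exists_quadratic_bump [T2Space M] {x₀ : M} {U : Set M} (hU : U ∈ 𝓝 x₀) :
    ∃ q : M → ℝ, ContMDiff (𝓡 m) 𝓘(ℝ, ℝ) ∞ q ∧ (∀ x, 0 ≤ q x) ∧ HasCompactSupport q ∧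
      tsupport q ⊆ U ∧
      q ∘ (extChartAt (𝓡 m) x₀).symm =ᶠ[𝓝 (extChartAt (𝓡 m) x₀ x₀)]
        fun p ↦ ‖p - extChartAt (𝓡 m) x₀ x₀‖ ^ 2 := by
  obtain ⟨χ, -, hχ⟩ := (SmoothBumpFunction.nhds_basis_tsupport (I := 𝓡 m) x₀).mem_iff.mp hU
  refine ⟨fun x ↦ χ x • ‖extChartAt (𝓡 m) x₀ x - extChartAt (𝓡 m) x₀ x₀‖ ^ 2,
    χ.contMDiff_smul ?_, fun x ↦ mul_nonneg χ.nonneg (by positivity),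
    χ.hasCompactSupport.smul_right, (tsupport_smul_subset_left _ _).trans hχ, ?_⟩
  · have hchart : ContMDiffOn (𝓡 m) 𝓘(ℝ, EuclideanSpace ℝ (Fin m)) ∞ (extChartAt (𝓡 m) x₀)
        (chartAt (EuclideanSpace ℝ (Fin m)) x₀).source := contMDiffOn_extChartAt
    have hnorm : ContDiff ℝ ∞ fun p ↦ ‖p - extChartAt (𝓡 m) x₀ x₀‖ ^ 2 :=
      (contDiff_id.sub contDiff_const).norm_sq ℝ
    exact hnorm.contMDiff.comp_contMDiffOn hchart
  · have hsymm := continuousAt_extChartAt_symm (I := 𝓡 m) x₀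
    rw [ContinuousAt, extChartAt_to_inv] at hsymm
    filter_upwards [hsymm.eventually χ.eventuallyEq_one,
      extChartAt_target_mem_nhds (I := 𝓡 m) x₀] with p hχp hp
    simp only [Function.comp_apply, hχp, (extChartAt (𝓡 m) x₀).right_inv hp, Pi.one_apply,
      one_smul]

variable [RiemannianBundle (fun x : M ↦ TangentSpace (𝓡 m) x)]

variable (m) in
/-- The trace, with respect to the metric at `x₀`, of the Euclidean scalar product of the preferred
chart at `x₀`. -/
def euclideanTrace (x₀ : M) : ℝ := ∑ i, ‖coframe x₀ x₀ (onb m x₀ i)‖ ^ 2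

theorem euclideanTrace_pos (hm : m ≠ 0) (x₀ : M) : 0 < euclideanTrace m x₀ := by
  have : NeZero m := ⟨hm⟩
  refine Finset.sum_pos (fun i _ ↦ ?_) Finset.univ_nonempty
  have hne : coframe x₀ x₀ (onb m x₀ i) ≠ 0 := fun h ↦
    (onb m x₀).orthonormal.ne_zero i ((coframe_eq_zero_iff (mem_extChartAt_source x₀)).mp h)
  positivity

theorem laplacian_eq_sum_of_critical {f : M → ℝ} {x₀ : M}
    (hf : ContDiffAt ℝ 2 (f ∘ (extChartAt (𝓡 m) x₀).symm) (extChartAt (𝓡 m) x₀ x₀))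
    (hcrit : ∀ u, mvfderiv (𝓡 m) f x₀ u = 0) :
    laplacian m f x₀ = ∑ i, fderiv ℝ (fderiv ℝ (f ∘ (extChartAt (𝓡 m) x₀).symm))
      (extChartAt (𝓡 m) x₀ x₀) (coframe x₀ x₀ (onb m x₀ i)) (coframe x₀ x₀ (onb m x₀ i)) := by
  refine Finset.sum_congr rfl fun i _ ↦ ?_
  have hlocal : (fun z ↦ mvfderiv (𝓡 m) f z (constField (onb m x₀ i) z)) ∘
      (extChartAt (𝓡 m) x₀).symm =ᶠ[𝓝 (extChartAt (𝓡 m) x₀ x₀)]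
      fun p ↦ fderiv ℝ (f ∘ (extChartAt (𝓡 m) x₀).symm) p (coframe x₀ x₀ (onb m x₀ i)) := by
    filter_upwards [hf.eventually (by simp), extChartAt_target_mem_nhds (I := 𝓡 m) x₀]
      with p hfp hp
    have hz := (extChartAt (𝓡 m) x₀).map_target hp
    have hfp' := hfp.differentiableAt two_ne_zero
    rw [← (extChartAt (𝓡 m) x₀).right_inv hp] at hfp'
    rw [Function.comp_apply, mvfderiv_eq_fderiv hz hfp', constField_eq_frame hz,
      coframe_frame hz, (extChartAt (𝓡 m) x₀).right_inv hp]
  have hderiv := ((differentiableAt_fderiv_of_contDiffAt_two hf).hasFDerivAt.clm_apply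
    (hasFDerivAt_const (coframe x₀ x₀ (onb m x₀ i)) _)).congr_of_eventuallyEq hlocal
  rw [hcrit, sub_zero, mvfderiv_eq_fderiv (mem_extChartAt_source x₀) hderiv.differentiableAt,
    hderiv.fderiv]
  simp

theorem laplacian_quadratic {f : M → ℝ} {x₀ : M} {c a : ℝ}
    (hf : f ∘ (extChartAt (𝓡 m) x₀).symm =ᶠ[𝓝 (extChartAt (𝓡 m) x₀ x₀)]
      fun p ↦ c + ‖p - extChartAt (𝓡 m) x₀ x₀‖ ^ 2 • a) :
    (∀ u, mvfderiv (𝓡 m) f x₀ u = 0) ∧ laplacian m f x₀ = 2 * euclideanTrace m x₀ * a := by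
  have hsmooth : ContDiffAt ℝ 2 (f ∘ (extChartAt (𝓡 m) x₀).symm) (extChartAt (𝓡 m) x₀ x₀) :=
    (contDiffAt_const.add (((contDiffAt_id.sub contDiffAt_const).norm_sq ℝ).smul
      contDiffAt_const)).congr_of_eventuallyEq hf
  have hcrit (u : TangentSpace (𝓡 m) x₀) : mvfderiv (𝓡 m) f x₀ u = 0 := by
    rw [mvfderiv_eq_fderiv (mem_extChartAt_source x₀) (hsmooth.differentiableAt two_ne_zero),
      hf.fderiv_eq, fderiv_const_add, fderiv_norm_sub_sq_smul]
    simp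
  refine ⟨hcrit, ?_⟩
  rw [laplacian_eq_sum_of_critical hsmooth hcrit, euclideanTrace, Finset.mul_sum, Finset.sum_mul]
  refine Finset.sum_congr rfl fun i _ ↦ ?_
  have hshift : fderiv ℝ (fun p ↦ c + ‖p - extChartAt (𝓡 m) x₀ x₀‖ ^ 2 • a)
      = fderiv ℝ fun p ↦ ‖p - extChartAt (𝓡 m) x₀ x₀‖ ^ 2 • a := funext fun p ↦ fderiv_const_add c
  rw [hf.fderiv.fderiv_eq, hshift, fderiv_fderiv_norm_sub_sq_smul,
    real_inner_self_eq_norm_sq, smul_eq_mul]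

end QuadraticBump

section Equation

variable {m n : ℕ}
  {M : Type*} [TopologicalSpace M] [T2Space M] [ChartedSpace (EuclideanSpace ℝ (Fin m)) M]
  [IsManifold (𝓡 m) ∞ M] [RiemannianBundle (fun x : M ↦ TangentSpace (𝓡 m) x)]
  {N : Type*} [TopologicalSpace N] [ChartedSpace (EuclideanSpace ℝ (Fin n)) N]
  [IsManifold (𝓡 n) ∞ N] [RiemannianBundle (fun y : N ↦ TangentSpace (𝓡 n) y)]
  [IsContMDiffRiemannianBundle (𝓡 n) ∞ (EuclideanSpace ℝ (Fin n))
      (fun y : N ↦ TangentSpace (𝓡 n) y)]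

theorem isHarmonic_of_fBitension_eq_zero {φ : M → N}
    (h : ∀ f : M → ℝ, ContMDiff (𝓡 m) 𝓘(ℝ, ℝ) ∞ f → (∀ x, 0 < f x) →
      ∀ x, fBitension m n φ f x = 0) : IsHarmonic m n φ := by
  intro x₀
  rcases eq_or_ne m 0 with rfl | hm
  · simp [tension]
  have hequation {f : M → ℝ} {a : ℝ} (hsmooth : ContMDiff (𝓡 m) 𝓘(ℝ, ℝ) ∞ f)
      (hpos : ∀ x, 0 < f x) (hquad : f ∘ (extChartAt (𝓡 m) x₀).symm
        =ᶠ[𝓝 (extChartAt (𝓡 m) x₀ x₀)] fun p ↦ 1 + ‖p - extChartAt (𝓡 m) x₀ x₀‖ ^ 2 • a) :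
      bitension m n φ x₀ + (2 * euclideanTrace m x₀ * a) • tension m n φ x₀ = 0 := by
    obtain ⟨hcrit, hlaplacian⟩ := laplacian_quadratic hquad
    have hvalue : f x₀ = 1 := by simpa using hquad.eq_of_nhds
    rw [← one_smul ℝ (bitension m n φ x₀), ← hvalue, ← hlaplacian,
      ← fBitension_of_mvfderiv_eq_zero φ hcrit]
    exact h f hsmooth hpos x₀
  obtain ⟨q, hq, hq_nonneg, -, -, hquad⟩ := exists_quadratic_bump (m := m) (x₀ := x₀) univ_mem
  have hone := hequation (a := 0) (f := fun _ ↦ 1) contMDiff_const (fun _ ↦ one_pos)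
    (Eventually.of_forall fun p ↦ by simp)
  have hbump := hequation (a := 1) (f := fun x ↦ 1 + q x) (contMDiff_const.add hq)
    (fun x ↦ add_pos_of_pos_of_nonneg one_pos (hq_nonneg x)) (by
      filter_upwards [hquad] with p hp
      simp only [Function.comp_apply] at hp ⊢
      rw [hp, smul_eq_mul, mul_one])
  rw [mul_zero, zero_smul, add_zero] at hone
  rw [hone, zero_add, mul_one] at hbump
  exact (smul_eq_zero.mp hbump).resolve_left
    (mul_pos two_pos (euclideanTrace_pos hm x₀)).ne'

end Equation
section DisjointedCover

variable {X : Type*} [TopologicalSpace X] {S : ℕ → Set X}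

theorem eventually_disjoint_disjointed (hcover : ⋃ k, interior (S k) = univ) {K : Set X}
    (hK : IsCompact K) : ∀ᶠ k in atTop, Disjoint K (disjointed S k) := by
  obtain ⟨t, ht⟩ := hK.elim_finite_subcover (fun k ↦ interior (S k)) (fun _ ↦ isOpen_interior)
    (hcover ▸ subset_univ K)
  filter_upwards [(Filter.eventually_all_finset t).mpr fun j _ ↦ eventually_gt_atTop j] with k hk
  rw [disjointed_eq_inter_compl]
  refine disjoint_left.mpr fun x hxK hx ↦ ?_
  obtain ⟨j, hj, hxj⟩ := mem_iUnion₂.mp (ht hxK)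
  exact mem_iInter₂.mp hx.2 j (hk j hj) (interior_subset hxj)

theorem exists_isOpen_subset_disjointed (hS : ∀ k, IsClosed (S k))
    (hcover : ⋃ k, interior (S k) = univ) {U : Set X} (hU : IsOpen U) (hne : U.Nonempty) :
    ∃ k, ∃ V ⊆ U ∩ disjointed S k, IsOpen V ∧ V.Nonempty := by
  have hmeets : ∃ k, (U ∩ interior (partialSups S k)).Nonempty := by
    obtain ⟨x, hx⟩ := hne
    obtain ⟨k, hk⟩ := mem_iUnion.mp (hcover ▸ mem_univ x)
    exact ⟨k, x, hx, interior_mono (le_partialSups S k) hk⟩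
  classical
  have hmin := fun j ↦ Nat.find_min hmeets (m := j)
  have hfind := Nat.find_spec hmeets
  rcases hk : Nat.find hmeets with _ | k
  · rw [hk, partialSups_zero] at hfind
    refine ⟨0, _, ?_, hU.inter isOpen_interior, hfind⟩
    rw [disjointed_zero]
    exact inter_subset_inter_right U interior_subset
  · rw [hk] at hfind
    have hclosed : IsClosed (partialSups S k) := by
      rw [partialSups_eq_biUnion_range]
      exact isClosed_biUnion_finset fun j _ ↦ hS j
    refine ⟨k + 1, (U ∩ interior (partialSups S (k + 1))) \ partialSups S k, ?_,
      (hU.inter isOpen_interior).sdiff hclosed, ?_⟩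
    · rintro x ⟨⟨hxU, hx⟩, hxk⟩
      have hx' := interior_subset hx
      rw [partialSups_add_one] at hx'
      refine ⟨hxU, ?_⟩
      rw [disjointed_add_one]
      exact ⟨hx'.resolve_left hxk, hxk⟩
    · -- Otherwise `U` would already meet the interior of an earlier partial union.
      by_contra hempty
      rw [not_nonempty_iff_eq_empty, sdiff_eq_empty] at hempty
      refine hmin k (hk ▸ k.lt_succ_self) (hfind.mono fun x hx ↦ ⟨hx.1, ?_⟩)
      exact interior_maximal hempty (hU.inter isOpen_interior) hx

end DisjointedCover

section Volume

variable {m : ℕ} {M : Type*} [TopologicalSpace M] [ChartedSpace (EuclideanSpace ℝ (Fin m)) M]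

theorem exists_isCompactChartCover [SecondCountableTopology M] [Nonempty M] :
    ∃ p : ℕ → M × Set M, IsCompactChartCover m M p := by
  have : LocallyCompactSpace M := ChartedSpace.locallyCompactSpace (EuclideanSpace ℝ (Fin m)) M
  choose K hK hxK hKs using fun x : M ↦ exists_compact_subset
    (chartAt (EuclideanSpace ℝ (Fin m)) x).open_source (mem_chart_source _ x)
  obtain ⟨s, hs, hcover⟩ := TopologicalSpace.countable_cover_nhds
    (f := fun x ↦ interior (K x)) fun x ↦ isOpen_interior.mem_nhds (hxK x)
  have hne : s.Nonempty := by
    by_contra! hempty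
    rw [hempty, biUnion_empty] at hcover
    exact empty_ne_univ hcover
  obtain ⟨c, rfl⟩ := hs.exists_eq_range hne
  refine ⟨fun k ↦ (c k, K (c k)), fun k ↦ ⟨hK _, hKs _⟩, ?_⟩
  rw [← hcover, biUnion_range]

theorem map_chart_symm_apply [MeasurableSpace M] [BorelSpace M] (x₀ : M) {S : Set M}
    (hS : MeasurableSet S) :
    (volume.restrict (chartAt (EuclideanSpace ℝ (Fin m)) x₀).target).map
      (chartAt (EuclideanSpace ℝ (Fin m)) x₀).symm S
      = volume ((chartAt (EuclideanSpace ℝ (Fin m)) x₀).target ∩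
        (chartAt (EuclideanSpace ℝ (Fin m)) x₀).symm ⁻¹' S) := by
  have hm := (chartAt (EuclideanSpace ℝ (Fin m)) x₀).open_target.measurableSet
  rw [Measure.map_apply_of_aemeasurable
    ((chartAt (EuclideanSpace ℝ (Fin m)) x₀).continuousOn_symm.aemeasurable hm) hS,
    Measure.restrict_apply' hm, inter_comm]

variable [IsManifold (𝓡 m) ∞ M]

theorem linearIndependent_constField {ι : Type*} {x₀ y : M}
    (hy : y ∈ (extChartAt (𝓡 m) x₀).source) {v : ι → TangentSpace (𝓡 m) x₀}
    (hv : LinearIndependent ℝ v) : LinearIndependent ℝ fun i ↦ constField (v i) y := by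
  simp only [constField_eq_frame hy]
  refine hv.map' ((frame x₀ y).comp (coframe x₀ x₀)).toLinearMap
    (LinearMap.ker_eq_bot'.mpr fun u hu ↦ ?_)
  have hcoframe := congrArg (coframe x₀ y) hu
  rwa [ContinuousLinearMap.coe_coe, ContinuousLinearMap.comp_apply, coframe_frame hy, map_zero,
    coframe_eq_zero_iff (mem_extChartAt_source x₀)] at hcoframe

variable [RiemannianBundle (fun x : M ↦ TangentSpace (𝓡 m) x)]

/-- The density `√(det (g_ij))` of the Riemannian measure with respect to Lebesgue measure in the
preferred chart at `x₀`. -/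
def chartDensity (x₀ y : M) : ℝ :=
  Real.sqrt (Matrix.of fun i j : Fin m ↦
    (inner ℝ (constField (y := x₀) (EuclideanSpace.single i (1 : ℝ)) y)
      (constField (y := x₀) (EuclideanSpace.single j (1 : ℝ)) y) : ℝ)).det

theorem chartDensity_pos {x₀ y : M} (hy : y ∈ (extChartAt (𝓡 m) x₀).source) :
    0 < chartDensity (m := m) x₀ y := by
  have hbasis : LinearIndependent ℝ
      fun i : Fin m ↦ (EuclideanSpace.single i (1 : ℝ) : TangentSpace (𝓡 m) x₀) :=
    (EuclideanSpace.orthonormal_single (𝕜 := ℝ)).linearIndependent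
  exact Real.sqrt_pos.mpr (Matrix.posDef_gram_of_linearIndependent
    (linearIndependent_constField hy hbasis)).det_pos

theorem chartVolume_apply [MeasurableSpace M] (x₀ : M) {S : Set M} (hS : MeasurableSet S) :
    chartVolume m x₀ S = ∫⁻ y in S, ENNReal.ofReal (chartDensity (m := m) x₀ y)
      ∂((volume.restrict (chartAt (EuclideanSpace ℝ (Fin m)) x₀).target).map
      (chartAt (EuclideanSpace ℝ (Fin m)) x₀).symm) :=
  withDensity_apply _ hS

variable [IsContMDiffRiemannianBundle (𝓡 m) ∞ (EuclideanSpace ℝ (Fin m))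
      (fun x : M ↦ TangentSpace (𝓡 m) x)]

theorem continuousOn_chartDensity (x₀ : M) :
    ContinuousOn (chartDensity (m := m) x₀) (extChartAt (𝓡 m) x₀).source := by
  refine ContinuousOn.sqrt (continuous_id.matrix_det.comp_continuousOn
    (continuousOn_pi.mpr fun i ↦ continuousOn_pi.mpr fun j ↦ ?_))
  refine ContinuousOn.congr (fun y hy ↦ (contMDiffAt_inner_frame hy
    (coframe x₀ x₀ (EuclideanSpace.single i (1 : ℝ)))
    (coframe x₀ x₀ (EuclideanSpace.single j (1 : ℝ)))).continuousAt.continuousWithinAt)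
    fun y hy ↦ congrArg₂ (inner ℝ) (constField_eq_frame hy _) (constField_eq_frame hy _)

variable [MeasurableSpace M] [BorelSpace M]

theorem chartVolume_pos {x₀ : M} {U : Set M} (hU : IsOpen U) (hne : U.Nonempty)
    (hUs : U ⊆ (chartAt (EuclideanSpace ℝ (Fin m)) x₀).source) : 0 < chartVolume m x₀ U := by
  obtain ⟨y, hy⟩ := hne
  have hys : y ∈ (extChartAt (𝓡 m) x₀).source := extChartAt_source (𝓡 m) x₀ ▸ hUs hy
  have hpos := chartDensity_pos hys
  have hcont : ContinuousAt (chartDensity (m := m) x₀) y :=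
    (continuousOn_chartDensity x₀).continuousAt (extChartAt_source_mem_nhds' hys)
  obtain ⟨V, hV, hVo, hyV⟩ := mem_nhds_iff.mp
    (inter_mem (hcont.eventually (lt_mem_nhds (half_lt_self hpos))) (hU.mem_nhds hy))
  calc
    0 < ENNReal.ofReal (chartDensity (m := m) x₀ y / 2) *
        volume ((chartAt (EuclideanSpace ℝ (Fin m)) x₀).target ∩
          (chartAt (EuclideanSpace ℝ (Fin m)) x₀).symm ⁻¹' V) := by
      refine ENNReal.mul_pos (by simpa using hpos) (IsOpen.measure_pos _
        ((chartAt (EuclideanSpace ℝ (Fin m)) x₀).symm.isOpen_inter_preimage hVo)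
        ⟨chartAt (EuclideanSpace ℝ (Fin m)) x₀ y,
          (chartAt (EuclideanSpace ℝ (Fin m)) x₀).map_source (hUs hy), ?_⟩).ne'
      rwa [mem_preimage, (chartAt (EuclideanSpace ℝ (Fin m)) x₀).left_inv (hUs hy)]
    _ ≤ chartVolume m x₀ V := by
      rw [← map_chart_symm_apply x₀ hVo.measurableSet, ← setLIntegral_const,
        chartVolume_apply x₀ hVo.measurableSet]
      exact setLIntegral_mono' hVo.measurableSet fun z hz ↦ ENNReal.ofReal_le_ofReal (hV hz).1.le
    _ ≤ chartVolume m x₀ U := measure_mono fun z hz ↦ (hV hz).2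

variable [T2Space M]

theorem chartVolume_lt_top {x₀ : M} {S : Set M} (hS : IsCompact S)
    (hSs : S ⊆ (chartAt (EuclideanSpace ℝ (Fin m)) x₀).source) : chartVolume m x₀ S < ⊤ := by
  obtain ⟨C, hC⟩ := hS.exists_bound_of_continuousOn
    ((continuousOn_chartDensity (m := m) x₀).mono (extChartAt_source (𝓡 m) x₀ ▸ hSs))
  rw [chartVolume_apply x₀ hS.measurableSet]
  refine setLIntegral_lt_top_of_le_nnreal ?_ ⟨C.toNNReal, fun y hy ↦
    ENNReal.ofReal_le_ofReal ((le_abs_self _).trans (hC y hy))⟩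
  rw [map_chart_symm_apply x₀ hS.measurableSet,
    ← (chartAt (EuclideanSpace ℝ (Fin m)) x₀).image_eq_target_inter_inv_preimage hSs]
  exact (hS.image_of_continuousOn
    ((chartAt (EuclideanSpace ℝ (Fin m)) x₀).continuousOn.mono hSs)).measure_lt_top.ne

instance instIsFiniteMeasureOnCompactsRiemannianVolume :
    IsFiniteMeasureOnCompacts (riemannianVolume m M) where
  lt_top_of_isCompact K hK := by
    rw [riemannianVolume]
    split_ifs with h
    swap
    · simp
    obtain ⟨hp, hcover⟩ := h.choose_spec
    obtain ⟨k₀, hk₀⟩ := eventually_atTop.mp (eventually_disjoint_disjointed hcover hK)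
    rw [Measure.sum_apply _ hK.measurableSet, tsum_eq_sum (s := Finset.range k₀)]
    · refine ENNReal.sum_lt_top.mpr fun k _ ↦ ?_
      rw [Measure.restrict_apply hK.measurableSet]
      exact (measure_mono (inter_subset_right.trans (disjointed_subset _ k))).trans_lt
        (chartVolume_lt_top (hp k).1 (hp k).2)
    · intro k hk
      rw [Finset.mem_range, not_lt] at hk
      rw [Measure.restrict_apply hK.measurableSet, (hk₀ k hk).inter_eq, measure_empty]

instance instIsOpenPosMeasureRiemannianVolume [SecondCountableTopology M] :
    (riemannianVolume m M).IsOpenPosMeasure where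
  open_pos U hU hne := by
    have : Nonempty M := hne.to_type
    have h := exists_isCompactChartCover (m := m) (M := M)
    rw [riemannianVolume, dif_pos h]
    obtain ⟨hp, hcover⟩ := h.choose_spec
    obtain ⟨k, V, hV, hVo, hVne⟩ :=
      exists_isOpen_subset_disjointed (fun k ↦ (hp k).1.isClosed) hcover hU hne
    refine (lt_of_lt_of_le ?_ ((Measure.le_sum _ k V).trans
      (measure_mono (hV.trans inter_subset_left)))).ne'
    rw [Measure.restrict_apply hVo.measurableSet,
      inter_eq_left.mpr (hV.trans inter_subset_right)]
    exact chartVolume_pos hVo hVne fun x hx ↦ (hp k).2 (disjointed_subset _ k (hV hx).2)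

end Volume

section ParametricDerivatives

theorem hasDerivAt_setIntegral_of_continuous {X E : Type*} [TopologicalSpace X] [T2Space X]
    [MeasurableSpace X] [BorelSpace X] [NormedAddCommGroup E] [NormedSpace ℝ E] {μ : Measure X}
    [IsFiniteMeasureOnCompacts μ] {K : Set X} (hK : IsCompact K) {F F' : ℝ × X → E}
    (hF : Continuous F) (hF' : Continuous F')
    (hderiv : ∀ t x, HasDerivAt (fun s ↦ F (s, x)) (F' (t, x)) t) (t : ℝ) :
    HasDerivAt (fun s ↦ ∫ x in K, F (s, x) ∂μ) (∫ x in K, F' (t, x) ∂μ) t := by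
  have hslice {G : ℝ × X → E} (hG : Continuous G) (s : ℝ) :
      IntegrableOn (fun x ↦ G (s, x)) K μ :=
    (hG.comp (Continuous.prodMk_right s)).continuousOn.integrableOn_compact hK
  obtain ⟨C, hC⟩ := ((isCompact_closedBall t 1).prod hK).exists_bound_of_continuousOn
    hF'.continuousOn
  have hbound : ∀ᵐ x ∂μ.restrict K, ∀ s ∈ Metric.closedBall t 1, ‖F' (s, x)‖ ≤ C :=
    (ae_restrict_mem hK.measurableSet).mono fun x hx s hs ↦ hC (s, x) ⟨hs, hx⟩
  exact (hasDerivAt_integral_of_dominated_loc_of_deriv_le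
    (Metric.closedBall_mem_nhds t one_pos)
    (.of_forall fun s ↦ (hslice hF s).aestronglyMeasurable) (hslice hF t)
    (hslice hF' t).aestronglyMeasurable hbound (integrableOn_const hK.measure_lt_top.ne)
    (.of_forall fun x s _ ↦ hderiv s x)).2

variable {E H M : Type*} [NormedAddCommGroup E] [NormedSpace ℝ E] [TopologicalSpace H]
  {I : ModelWithCorners ℝ E H} [TopologicalSpace M] [ChartedSpace H M] {F : ℝ × M → ℝ}

theorem hasDerivAt_fst_of_contMDiff (hF : ContMDiff (𝓘(ℝ, ℝ).prod I) 𝓘(ℝ, ℝ) 1 F) (t : ℝ) (x : M) :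
    HasDerivAt (fun s ↦ F (s, x)) (deriv (fun s ↦ F (s, x)) t) t :=
  ((hF.comp (contMDiff_id.prodMk contMDiff_const)).contDiff.differentiable one_ne_zero
    t).hasDerivAt

theorem continuous_deriv_fst_of_contMDiff [IsManifold I 1 M]
    (hF : ContMDiff (𝓘(ℝ, ℝ).prod I) 𝓘(ℝ, ℝ) 1 F) :
    Continuous fun z : ℝ × M ↦ deriv (fun s ↦ F (s, z.2)) z.1 := by
  refine continuous_iff_continuousAt.mpr fun z₀ ↦ ?_
  have hfamily : ContMDiffAt ((𝓘(ℝ, ℝ).prod I).prod 𝓘(ℝ, ℝ)) 𝓘(ℝ, ℝ) 1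
      (Function.uncurry fun (z : ℝ × M) (s : ℝ) ↦ F (s, z.2)) (z₀, z₀.1) :=
    (hF.comp (contMDiff_snd.prodMk (contMDiff_snd.comp contMDiff_fst))).contMDiffAt
  have hmfderiv := (ContMDiffAt.mfderiv (m := 0) (fun (z : ℝ × M) (s : ℝ) ↦ F (s, z.2)) Prod.fst
    hfamily contMDiffAt_fst (by norm_num)).continuousAt
  have hfderiv : ContinuousAt (fun z : ℝ × M ↦ fderiv ℝ (fun s ↦ F (s, z.2)) z.1) z₀ := by
    simp_rw [← mfderiv_eq_fderiv]
    exact hmfderiv.congr <| .of_forall <| congrFun <|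
      inTangentCoordinates_model_space (I := 𝓘(ℝ, ℝ)) (I' := 𝓘(ℝ, ℝ)) _ _ _ z₀
  exact hfderiv.clm_apply continuousAt_const

end ParametricDerivatives

section Families

variable {m n : ℕ}
  {M : Type*} [TopologicalSpace M] [ChartedSpace (EuclideanSpace ℝ (Fin m)) M]
  {N : Type*} [TopologicalSpace N] [ChartedSpace (EuclideanSpace ℝ (Fin n)) N]
  {D : Type*} [NormedAddCommGroup D] [NormedSpace ℝ D] {Φ : D → M → N}

theorem contMDiff_of_family
    (hΦ : ContMDiff (𝓘(ℝ, D).prod (𝓡 m)) (𝓡 n) ∞ fun z : D × M ↦ Φ z.1 z.2) (t : D) :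
    ContMDiff (𝓡 m) (𝓡 n) ∞ (Φ t) :=
  hΦ.comp (contMDiff_const.prodMk contMDiff_id)

variable [IsManifold (𝓡 m) ∞ M] [IsManifold (𝓡 n) ∞ N]

theorem contDiffAt_chartMap_family
    (hΦ : ContMDiff (𝓘(ℝ, D).prod (𝓡 m)) (𝓡 n) ∞ fun z : D × M ↦ Φ z.1 z.2) {x₀ x : M} {y₀ : N}
    {t : D} (hx : x ∈ (extChartAt (𝓡 m) x₀).source)
    (hy : Φ t x ∈ (extChartAt (𝓡 n) y₀).source) :
    ContDiffAt ℝ ∞ (fun z : D × EuclideanSpace ℝ (Fin m) ↦ chartMap m n (Φ z.1) x₀ y₀ z.2)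
      (t, extChartAt (𝓡 m) x₀ x) := by
  rw [← contMDiffAt_iff_contDiffAt]
  have hsymm : ContMDiffAt 𝓘(ℝ, EuclideanSpace ℝ (Fin m)) (𝓡 m) ∞ (extChartAt (𝓡 m) x₀).symm
      (extChartAt (𝓡 m) x₀ x) :=
    (contMDiffOn_extChartAt_symm x₀).contMDiffAt
      (extChartAt_target_mem_nhds' ((extChartAt (𝓡 m) x₀).map_source hx))
  have hpair : ContMDiffAt 𝓘(ℝ, D × EuclideanSpace ℝ (Fin m)) (𝓘(ℝ, D).prod (𝓡 m)) ∞
      (fun z : D × EuclideanSpace ℝ (Fin m) ↦ (z.1, (extChartAt (𝓡 m) x₀).symm z.2))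
      (t, extChartAt (𝓡 m) x₀ x) :=
    contDiff_fst.contMDiff.contMDiffAt.prodMk
      (hsymm.comp (t, extChartAt (𝓡 m) x₀ x) contDiff_snd.contMDiff.contMDiffAt)
  have hchart : ContMDiffAt (𝓡 n) 𝓘(ℝ, EuclideanSpace ℝ (Fin n)) ∞ (extChartAt (𝓡 n) y₀) (Φ t x) :=
    contMDiffAt_extChartAt' (by simpa using hy)
  exact ContMDiffAt.comp_of_eq (I' := 𝓘(ℝ, D).prod (𝓡 m))
    (g := fun z : D × M ↦ extChartAt (𝓡 n) y₀ (Φ z.1 z.2))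
    (hchart.comp (t, x) hΦ.contMDiffAt) hpair
    (Prod.ext rfl ((extChartAt (𝓡 m) x₀).left_inv hx))

variable [RiemannianBundle (fun x : M ↦ TangentSpace (𝓡 m) x)]
  [IsContMDiffRiemannianBundle (𝓡 m) ∞ (EuclideanSpace ℝ (Fin m))
      (fun x : M ↦ TangentSpace (𝓡 m) x)]
  [RiemannianBundle (fun y : N ↦ TangentSpace (𝓡 n) y)]
  [IsContMDiffRiemannianBundle (𝓡 n) ∞ (EuclideanSpace ℝ (Fin n))
      (fun y : N ↦ TangentSpace (𝓡 n) y)]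

theorem contMDiff_normSq_tension
    (hΦ : ContMDiff (𝓘(ℝ, D).prod (𝓡 m)) (𝓡 n) ∞ fun z : D × M ↦ Φ z.1 z.2) :
    ContMDiff (𝓘(ℝ, D).prod (𝓡 m)) 𝓘(ℝ, ℝ) ∞
      fun z : D × M ↦ ‖tension m n (Φ z.1) z.2‖ ^ 2 := by
  rintro ⟨t₀, x₀⟩
  have hx := mem_extChartAt_source (I := 𝓡 m) x₀
  have hy := mem_extChartAt_source (I := 𝓡 n) (Φ t₀ x₀)
  have hmap := contDiffAt_chartMap_family hΦ hx hy
  have hvalue := chartMap_extChartAt (n := n) (Φ t₀) (Φ t₀ x₀) hx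
  have hpt := (extChartAt (𝓡 m) x₀).map_source hx
  have hyt := (extChartAt (𝓡 n) (Φ t₀ x₀)).map_source hy
  rw [← hvalue] at hyt
  have htension := contDiffAt_metricTrace_covHess hmap (contDiffAt_chartMetric hpt)
    (isInvertible_chartMetric hpt) (contDiffAt_chartMetric hyt) (isInvertible_chartMetric hyt)
  have hmetric := (contDiffAt_chartMetric hyt).comp (t₀, extChartAt (𝓡 m) x₀ x₀) hmap
  have hcoords : ContMDiffAt (𝓘(ℝ, D).prod (𝓡 m)) 𝓘(ℝ, D × EuclideanSpace ℝ (Fin m)) ∞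
      (fun z : D × M ↦ (z.1, extChartAt (𝓡 m) x₀ z.2)) (t₀, x₀) :=
    contMDiffAt_fst.prodMk_space (contMDiffAt_extChartAt.comp (t₀, x₀) contMDiffAt_snd)
  refine (((hmetric.clm_apply htension).clm_apply htension).contMDiffAt.comp (t₀, x₀)
    hcoords).congr_of_eventuallyEq ?_
  filter_upwards [continuousAt_snd.eventually (extChartAt_source_mem_nhds (I := 𝓡 m) x₀),
    hΦ.continuous.continuousAt.eventually (extChartAt_source_mem_nhds (I := 𝓡 n) (Φ t₀ x₀))]
    with z hzx hzy
  rw [normSq_tension (contMDiff_of_family hΦ z.1) hzx hzy, ← chartMap_extChartAt _ _ hzx]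
  rfl

end Families

section Energy

variable {m n : ℕ}
  {M : Type*} [TopologicalSpace M] [ChartedSpace (EuclideanSpace ℝ (Fin m)) M]
  {N : Type*} [TopologicalSpace N] [ChartedSpace (EuclideanSpace ℝ (Fin n)) N]

theorem IsVariation.mono {φ : M → N} {K K' : Set M} {Φ : ℝ → M → N} (hΦ : IsVariation m n φ K Φ)
    (hK : K ⊆ K') : IsVariation m n φ K' Φ :=
  ⟨hΦ.smooth, hΦ.zero, fun t x hx ↦ hΦ.eq_off t x fun hxK ↦ hx (hK hxK)⟩

variable [IsManifold (𝓡 m) ∞ M] [RiemannianBundle (fun x : M ↦ TangentSpace (𝓡 m) x)]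
  [IsContMDiffRiemannianBundle (𝓡 m) ∞ (EuclideanSpace ℝ (Fin m))
      (fun x : M ↦ TangentSpace (𝓡 m) x)]
  [IsManifold (𝓡 n) ∞ N] [RiemannianBundle (fun y : N ↦ TangentSpace (𝓡 n) y)]
  [IsContMDiffRiemannianBundle (𝓡 n) ∞ (EuclideanSpace ℝ (Fin n))
      (fun y : N ↦ TangentSpace (𝓡 n) y)]

theorem continuous_deriv_normSq_tension {Φ : ℝ → M → N}
    (hΦ : ContMDiff (𝓘(ℝ, ℝ).prod (𝓡 m)) (𝓡 n) ∞ fun z : ℝ × M ↦ Φ z.1 z.2) (t : ℝ) :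
    Continuous fun x ↦ deriv (fun s ↦ ‖tension m n (Φ s) x‖ ^ 2) t :=
  Continuous.uncurry_left (f := fun t x ↦ deriv (fun s ↦ ‖tension m n (Φ s) x‖ ^ 2) t) t
    (continuous_deriv_fst_of_contMDiff ((contMDiff_normSq_tension hΦ).of_le (by simp)))

variable [T2Space M] [MeasurableSpace M] [BorelSpace M]

theorem hasDerivAt_fBienergy {f : M → ℝ} (hf : Continuous f) {K : Set M} (hK : IsCompact K)
    {Φ : ℝ → M → N}
    (hΦ : ContMDiff (𝓘(ℝ, ℝ).prod (𝓡 m)) (𝓡 n) ∞ fun z : ℝ × M ↦ Φ z.1 z.2) (t : ℝ) :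
    HasDerivAt (fun s ↦ fBienergy m n f K (Φ s))
      ((1 / 2) * ∫ x in K, f x * deriv (fun s ↦ ‖tension m n (Φ s) x‖ ^ 2) t
        ∂(riemannianVolume m M)) t := by
  have hsmooth := (contMDiff_normSq_tension hΦ).of_le (m := 1) (by simp)
  have hfst : Continuous fun z : ℝ × M ↦ f z.2 := hf.comp continuous_snd
  exact (hasDerivAt_setIntegral_of_continuous hK (hfst.mul hsmooth.continuous)
    (hfst.mul (continuous_deriv_fst_of_contMDiff hsmooth))
    (fun s x ↦ (hasDerivAt_fst_of_contMDiff hsmooth s x).const_mul (f x)) t).const_mul (1 / 2)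

theorem isFBiharmonic_of_isHarmonic {φ : M → N} (hφ : IsHarmonic m n φ) {f : M → ℝ}
    (hf : Continuous f) : IsFBiharmonic m n φ f := by
  intro K Φ hK hΦ
  have hstationary (x : M) : deriv (fun t ↦ ‖tension m n (Φ t) x‖ ^ 2) 0 = 0 := by
    refine IsLocalMin.deriv_eq_zero (.of_forall fun t ↦ ?_)
    calc ‖tension m n (Φ 0) x‖ ^ 2 = 0 := by rw [hΦ.zero, hφ x, norm_zero, zero_pow two_ne_zero]
      _ ≤ ‖tension m n (Φ t) x‖ ^ 2 := sq_nonneg _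
  simpa only [hstationary, mul_zero, integral_zero] using hasDerivAt_fBienergy hf hK hΦ.smooth 0

theorem integral_mul_deriv_normSq_tension_eq_zero {φ : M → N}
    (hφ : ∀ f : M → ℝ, ContMDiff (𝓡 m) 𝓘(ℝ, ℝ) ∞ f → (∀ x, 0 < f x) → IsFBiharmonic m n φ f)
    {K : Set M} (hK : IsCompact K) {Φ : ℝ → M → N} (hΦ : IsVariation m n φ K Φ)
    {g : M → ℝ} (hg : ContMDiff (𝓡 m) 𝓘(ℝ, ℝ) ∞ g) :
    ∫ x in K, g x * deriv (fun t ↦ ‖tension m n (Φ t) x‖ ^ 2) 0 ∂(riemannianVolume m M) = 0 := by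
  set e : M → ℝ := fun x ↦ deriv (fun t ↦ ‖tension m n (Φ t) x‖ ^ 2) 0
  have he : Continuous e := continuous_deriv_normSq_tension hΦ.smooth 0
  have hintegrable {f : M → ℝ} (hf : ContMDiff (𝓡 m) 𝓘(ℝ, ℝ) ∞ f) :
      IntegrableOn (fun x ↦ f x * e x) K (riemannianVolume m M) :=
    (hf.continuous.mul he).continuousOn.integrableOn_compact hK
  have hpositive {f : M → ℝ} (hf : ContMDiff (𝓡 m) 𝓘(ℝ, ℝ) ∞ f) (hpos : ∀ x, 0 < f x) :
      ∫ x in K, f x * e x ∂(riemannianVolume m M) = 0 := by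
    have hunique := (hasDerivAt_fBienergy hf.continuous hK hΦ.smooth 0).unique
      (hφ f hf hpos K Φ hK hΦ)
    simpa using hunique
  -- `g` is the difference of the positive functions `g² + g + 1` and `g² + 1`.
  have hsq : ContMDiff (𝓡 m) 𝓘(ℝ, ℝ) ∞ fun x ↦ g x * g x + 1 :=
    (hg.mul hg).add contMDiff_const
  have hsqAdd : ContMDiff (𝓡 m) 𝓘(ℝ, ℝ) ∞ fun x ↦ g x * g x + 1 + g x := hsq.add hg
  calc ∫ x in K, g x * e x ∂(riemannianVolume m M)
      = ∫ x in K, ((g x * g x + 1 + g x) * e x - (g x * g x + 1) * e x) ∂(riemannianVolume m M) :=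
        integral_congr_ae (.of_forall fun x ↦ by ring)
    _ = 0 := by
      rw [integral_sub (hintegrable hsqAdd) (hintegrable hsq),
        hpositive hsqAdd fun x ↦ by nlinarith [sq_nonneg (g x + 1)],
        hpositive hsq fun x ↦ by nlinarith [sq_nonneg (g x)], sub_zero]

theorem deriv_normSq_tension_eq_zero [SecondCountableTopology M] {φ : M → N}
    (hφ : ∀ f : M → ℝ, ContMDiff (𝓡 m) 𝓘(ℝ, ℝ) ∞ f → (∀ x, 0 < f x) → IsFBiharmonic m n φ f)
    {K : Set M} (hK : IsCompact K) {Φ : ℝ → M → N} (hΦ : IsVariation m n φ K Φ) (x : M) :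
    deriv (fun t ↦ ‖tension m n (Φ t) x‖ ^ 2) 0 = 0 := by
  have hcont := continuous_deriv_normSq_tension hΦ.smooth 0
  have := ChartedSpace.locallyCompactSpace (EuclideanSpace ℝ (Fin m)) M
  refine congrFun ((hcont.ae_eq_iff_eq (riemannianVolume m M) continuous_const).mp
    (ae_eq_zero_of_integral_contMDiff_smul_eq_zero (𝓡 m) hcont.locallyIntegrable
      fun g hg hsupp ↦ ?_)) x
  rw [← setIntegral_eq_integral_of_forall_compl_eq_zero (s := K ∪ tsupport g) fun x hx ↦ by
    rw [image_eq_zero_of_notMem_tsupport fun hxg ↦ hx (.inr hxg), zero_smul]]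
  exact integral_mul_deriv_normSq_tension_eq_zero hφ (hK.union hsupp)
    (hΦ.mono subset_union_left) hg

end Energy

section Variation

theorem exists_pos_forall_add_smul_mem {X F : Type*} [TopologicalSpace X] [NormedAddCommGroup F]
    [NormedSpace ℝ F] {K : Set X} (hK : IsCompact K) {c w : X → F}
    (hc : ∀ x ∈ K, ContinuousAt c x) (hw : ∀ x ∈ K, ContinuousAt w x) {U : Set F} (hU : IsOpen U)
    (hcU : MapsTo c K U) : ∃ δ : ℝ, 0 < δ ∧ ∀ s : ℝ, |s| ≤ δ → ∀ x ∈ K, c x + s • w x ∈ U := by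
  have hnear : ∀ᶠ s : ℝ in 𝓝 0, ∀ x ∈ K, c x + s • w x ∈ U := by
    refine hK.eventually_forall_of_forall_eventually fun x hx ↦ ?_
    have hcont : ContinuousAt (fun z : ℝ × X ↦ c z.2 + z.1 • w z.2) (0, x) :=
      ((hc x hx).comp continuousAt_snd).add
        (continuousAt_fst.smul ((hw x hx).comp continuousAt_snd))
    exact hcont.eventually (hU.mem_nhds (by simpa using hcU hx))
  obtain ⟨δ, hδ, hball⟩ := Metric.nhds_basis_closedBall.eventually_iff.mp hnear
  exact ⟨δ, hδ, fun s hs ↦ hball (by simpa using hs)⟩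

variable {n : ℕ} {N : Type*} [TopologicalSpace N] [ChartedSpace (EuclideanSpace ℝ (Fin n)) N]

open Classical in
/-- The point obtained from `y` by adding `v` to its coordinates in the preferred chart at `y₀`.
Points outside the domain of the chart are left fixed. -/
def chartShift (y₀ : N) (v : EuclideanSpace ℝ (Fin n)) (y : N) : N :=
  if y ∈ (extChartAt (𝓡 n) y₀).source then
    (extChartAt (𝓡 n) y₀).symm (extChartAt (𝓡 n) y₀ y + v)
  else y

theorem chartShift_zero (y₀ y : N) : chartShift y₀ (0 : EuclideanSpace ℝ (Fin n)) y = y := by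
  by_cases hy : y ∈ (extChartAt (𝓡 n) y₀).source
  · rw [chartShift, if_pos hy, add_zero, (extChartAt (𝓡 n) y₀).left_inv hy]
  · rw [chartShift, if_neg hy]

theorem extChartAt_chartShift {y₀ y : N} {v : EuclideanSpace ℝ (Fin n)}
    (hy : y ∈ (extChartAt (𝓡 n) y₀).source)
    (hv : extChartAt (𝓡 n) y₀ y + v ∈ (extChartAt (𝓡 n) y₀).target) :
    extChartAt (𝓡 n) y₀ (chartShift y₀ v y) = extChartAt (𝓡 n) y₀ y + v := by
  rw [chartShift, if_pos hy, (extChartAt (𝓡 n) y₀).right_inv hv]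

variable [IsManifold (𝓡 n) ∞ N]

theorem contMDiffAt_chartShift {y₀ y : N} {v : EuclideanSpace ℝ (Fin n)}
    (hy : y ∈ (extChartAt (𝓡 n) y₀).source)
    (hv : extChartAt (𝓡 n) y₀ y + v ∈ (extChartAt (𝓡 n) y₀).target) :
    ContMDiffAt ((𝓡 n).prod 𝓘(ℝ, EuclideanSpace ℝ (Fin n))) (𝓡 n) ∞
      (fun z : N × EuclideanSpace ℝ (Fin n) ↦ chartShift y₀ z.2 z.1) (y, v) := by
  have hchart : ContMDiffAt (𝓡 n) 𝓘(ℝ, EuclideanSpace ℝ (Fin n)) ∞ (extChartAt (𝓡 n) y₀) y :=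
    contMDiffAt_extChartAt' (by simpa using hy)
  have hsymm : ContMDiffAt 𝓘(ℝ, EuclideanSpace ℝ (Fin n)) (𝓡 n) ∞ (extChartAt (𝓡 n) y₀).symm
      (extChartAt (𝓡 n) y₀ y + v) :=
    (contMDiffOn_extChartAt_symm y₀).contMDiffAt ((isOpen_extChartAt_target y₀).mem_nhds hv)
  have hsum : ContMDiffAt ((𝓡 n).prod 𝓘(ℝ, EuclideanSpace ℝ (Fin n)))
      𝓘(ℝ, EuclideanSpace ℝ (Fin n)) ∞
      (fun z : N × EuclideanSpace ℝ (Fin n) ↦ extChartAt (𝓡 n) y₀ z.1 + z.2) (y, v) :=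
    (hchart.comp (y, v) contMDiffAt_fst).add contMDiffAt_snd
  refine (hsymm.comp (y, v) hsum).congr_of_eventuallyEq ?_
  filter_upwards [continuousAt_fst.eventually ((isOpen_extChartAt_source y₀).mem_nhds hy)] with z hz
  exact if_pos hz

variable {m : ℕ} {M : Type*} [TopologicalSpace M] [ChartedSpace (EuclideanSpace ℝ (Fin m)) M]

theorem isVariation_chartShift {φ : M → N} (hφ : ContMDiff (𝓡 m) (𝓡 n) ∞ φ) {q : M → ℝ}
    (hq : ContMDiff (𝓡 m) 𝓘(ℝ, ℝ) ∞ q) {s : ℝ → ℝ} (hs : ContDiff ℝ ∞ s) (hs0 : s 0 = 0)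
    {y₀ : N} {v : EuclideanSpace ℝ (Fin n)}
    (hsource : ∀ x ∈ tsupport q, φ x ∈ (extChartAt (𝓡 n) y₀).source)
    (htarget : ∀ t, ∀ x ∈ tsupport q,
      extChartAt (𝓡 n) y₀ (φ x) + s t • q x • v ∈ (extChartAt (𝓡 n) y₀).target) :
    IsVariation m n φ (tsupport q) fun t x ↦ chartShift y₀ (s t • q x • v) (φ x) := by
  have hoff (t : ℝ) {x : M} (hx : q x = 0) : chartShift y₀ (s t • q x • v) (φ x) = φ x := by
    rw [hx, zero_smul, smul_zero, chartShift_zero]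
  refine ⟨?_, ?_, fun t x hx ↦ hoff t (image_eq_zero_of_notMem_tsupport hx)⟩
  · rintro ⟨t, x⟩
    have hφx : ContMDiffAt (𝓘(ℝ, ℝ).prod (𝓡 m)) (𝓡 n) ∞ (fun z : ℝ × M ↦ φ z.2) (t, x) :=
      hφ.contMDiffAt.comp (t, x) contMDiffAt_snd
    by_cases hx : x ∈ tsupport q
    · have hsmul : ContMDiffAt (𝓘(ℝ, ℝ).prod (𝓡 m)) 𝓘(ℝ, EuclideanSpace ℝ (Fin n)) ∞
          (fun z : ℝ × M ↦ s z.1 • q z.2 • v) (t, x) :=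
        (hs.contMDiff.contMDiffAt.comp (t, x) contMDiffAt_fst).smul
          ((hq.contMDiffAt.comp (t, x) contMDiffAt_snd).smul contMDiffAt_const)
      exact (contMDiffAt_chartShift (hsource x hx) (htarget t x hx)).comp (t, x)
        (hφx.prodMk hsmul)
    · refine hφx.congr_of_eventuallyEq ?_
      filter_upwards [continuousAt_snd.eventually (notMem_tsupport_iff_eventuallyEq.mp hx)]
        with z hz using hoff z.1 hz
  · funext x
    rw [hs0, zero_smul, chartShift_zero]

variable [IsManifold (𝓡 m) ∞ M]

theorem exists_quadratic_variation [T2Space M] {φ : M → N} (hφ : ContMDiff (𝓡 m) (𝓡 n) ∞ φ)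
    (x₀ : M) (v : EuclideanSpace ℝ (Fin n)) :
    ∃ (K : Set M) (Φ : ℝ → M → N) (δ : ℝ), IsCompact K ∧ IsVariation m n φ K Φ ∧ 0 < δ ∧
      (∀ t, Φ t x₀ = φ x₀) ∧
      ∀ t, chartMap m n (Φ t) x₀ (φ x₀) =ᶠ[𝓝 (extChartAt (𝓡 m) x₀ x₀)]
        fun p ↦ chartMap m n φ x₀ (φ x₀) p
          + ‖p - extChartAt (𝓡 m) x₀ x₀‖ ^ 2 • (δ * Real.sin t) • v := by
  set c := extChartAt (𝓡 n) (φ x₀)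
  have hsourceOpen : IsOpen (φ ⁻¹' c.source) :=
    (isOpen_extChartAt_source (φ x₀)).preimage hφ.continuous
  have hsource_nhds : φ ⁻¹' c.source ∈ 𝓝 x₀ :=
    hsourceOpen.mem_nhds (mem_extChartAt_source (φ x₀))
  obtain ⟨q, hq, -, hcompact, hsupp, hquad⟩ := exists_quadratic_bump (m := m) hsource_nhds
  obtain ⟨δ, hδ, hsmall⟩ := exists_pos_forall_add_smul_mem hcompact (c := c ∘ φ)
    (w := fun x ↦ q x • v)
    (fun x hx ↦ (continuousAt_extChartAt' (hsupp hx)).comp hφ.continuous.continuousAt)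
    (fun x _ ↦ (hq.continuous.smul continuous_const).continuousAt)
    (isOpen_extChartAt_target (φ x₀)) fun x hx ↦ c.map_source (hsupp hx)
  -- The factor `sin` keeps the shift inside the chart for all times.
  have hsin (t : ℝ) : |δ * Real.sin t| ≤ δ := by
    rw [abs_mul, abs_of_pos hδ]
    exact mul_le_of_le_one_right hδ.le (Real.abs_sin_le_one t)
  have htarget (t : ℝ) {x : M} (hx : φ x ∈ c.source) :
      c (φ x) + (δ * Real.sin t) • q x • v ∈ c.target := by
    by_cases hxq : x ∈ tsupport q
    · exact hsmall _ (hsin t) x hxq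
    · simpa [image_eq_zero_of_notMem_tsupport hxq] using c.map_source hx
  refine ⟨tsupport q, fun t x ↦ chartShift (φ x₀) ((δ * Real.sin t) • q x • v) (φ x), δ, hcompact,
    isVariation_chartShift hφ hq (contDiff_const.mul Real.contDiff_sin) (by simp)
      (fun x hx ↦ hsupp hx) fun t x hx ↦ htarget t (hsupp hx), hδ, fun t ↦ ?_, fun t ↦ ?_⟩
  · have hqx : q x₀ = 0 := by simpa using hquad.self_of_nhds
    simp only [hqx, zero_smul, smul_zero, chartShift_zero]
  · filter_upwards [eventually_mem_source_of_continuousAt hφ.continuous.continuousAt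
      (mem_extChartAt_source (I := 𝓡 m) x₀) (mem_extChartAt_source (I := 𝓡 n) (φ x₀)), hquad]
      with p hp hqp
    rw [Function.comp_apply] at hqp
    simp only [chartMap, Function.comp_apply]
    rw [extChartAt_chartShift hp.2 (htarget t hp.2), hqp, smul_comm]

end Variation

section SecondVariation

theorem covHess_add_of_critical {E F : Type*} [NormedAddCommGroup E] [NormedSpace ℝ E]
    [NormedAddCommGroup F] [NormedSpace ℝ F] {G : E → E →L[ℝ] E →L[ℝ] ℝ}
    {H : F → F →L[ℝ] F →L[ℝ] ℝ} {ψ χ : E → F} {p : E} (hψ : ContDiffAt ℝ 2 ψ p)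
    (hχ : ContDiffAt ℝ 2 χ p) (hzero : χ p = 0) (hcrit : fderiv ℝ χ p = 0) :
    covHess G H (ψ + χ) p = covHess G H ψ p + fderiv ℝ (fderiv ℝ χ) p := by
  have hdiff {θ : E → F} (hθ : ContDiffAt ℝ 2 θ p) : ∀ᶠ q in 𝓝 p, DifferentiableAt ℝ θ q :=
    (hθ.eventually (by simp)).mono fun q hq ↦ hq.differentiableAt two_ne_zero
  have hfderiv : fderiv ℝ (ψ + χ) =ᶠ[𝓝 p] fderiv ℝ ψ + fderiv ℝ χ := by
    filter_upwards [hdiff hψ, hdiff hχ] with q hqψ hqχ using fderiv_add hqψ hqχ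
  have hfderiv_at : fderiv ℝ (ψ + χ) p = fderiv ℝ ψ p := by
    rw [hfderiv.self_of_nhds, Pi.add_apply, hcrit, add_zero]
  have hsecond : fderiv ℝ (fderiv ℝ (ψ + χ)) p
      = fderiv ℝ (fderiv ℝ ψ) p + fderiv ℝ (fderiv ℝ χ) p := by
    rw [hfderiv.fderiv_eq, fderiv_add (differentiableAt_fderiv_of_contDiffAt_two hψ)
      (differentiableAt_fderiv_of_contDiffAt_two hχ)]
  rw [covHess, covHess, hfderiv_at, hsecond, Pi.add_apply, hzero, add_zero]
  abel

variable {m n : ℕ}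
  {M : Type*} [TopologicalSpace M] [ChartedSpace (EuclideanSpace ℝ (Fin m)) M]
  [IsManifold (𝓡 m) ∞ M] [RiemannianBundle (fun x : M ↦ TangentSpace (𝓡 m) x)]
  [IsContMDiffRiemannianBundle (𝓡 m) ∞ (EuclideanSpace ℝ (Fin m))
      (fun x : M ↦ TangentSpace (𝓡 m) x)]
  {N : Type*} [TopologicalSpace N] [ChartedSpace (EuclideanSpace ℝ (Fin n)) N]
  [IsManifold (𝓡 n) ∞ N] [RiemannianBundle (fun y : N ↦ TangentSpace (𝓡 n) y)]
  [IsContMDiffRiemannianBundle (𝓡 n) ∞ (EuclideanSpace ℝ (Fin n))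
      (fun y : N ↦ TangentSpace (𝓡 n) y)]

theorem coframe_tension_add_quadratic {φ ψ : M → N} (hφ : ContMDiff (𝓡 m) (𝓡 n) ∞ φ)
    (hψ : ContMDiff (𝓡 m) (𝓡 n) ∞ ψ) {x₀ : M} {v : EuclideanSpace ℝ (Fin n)}
    (hvalue : ψ x₀ = φ x₀)
    (hquad : chartMap m n ψ x₀ (φ x₀) =ᶠ[𝓝 (extChartAt (𝓡 m) x₀ x₀)]
      fun p ↦ chartMap m n φ x₀ (φ x₀) p + ‖p - extChartAt (𝓡 m) x₀ x₀‖ ^ 2 • v) :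
    coframe (φ x₀) (ψ x₀) (tension m n ψ x₀)
      = coframe (φ x₀) (φ x₀) (tension m n φ x₀) + (2 * euclideanTrace m x₀) • v := by
  have hx := mem_extChartAt_source (I := 𝓡 m) x₀
  have hy := mem_extChartAt_source (I := 𝓡 n) (φ x₀)
  set p₀ := extChartAt (𝓡 m) x₀ x₀
  have hsmooth : ContDiff ℝ 2 fun p ↦ ‖p - p₀‖ ^ 2 • v :=
    ((contDiff_id.sub contDiff_const).norm_sq ℝ).smul contDiff_const
  have hhess : chartHess m n ψ x₀ (φ x₀) p₀ = chartHess m n φ x₀ (φ x₀) p₀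
      + fderiv ℝ (fderiv ℝ fun p ↦ ‖p - p₀‖ ^ 2 • v) p₀ :=
    (covHess_congr hquad).trans <| covHess_add_of_critical
      ((contDiffAt_chartMap hφ.contMDiffAt hx hy).of_le ENat.LEInfty.out) hsmooth.contDiffAt
      (by simp) (by ext; simp [fderiv_norm_sub_sq_smul])
  have htrace (L : EuclideanSpace ℝ (Fin m) →L[ℝ] EuclideanSpace ℝ (Fin m) →L[ℝ]
      EuclideanSpace ℝ (Fin n)) := metricTrace_eq_sum
    (isInvertible_chartMetric ((extChartAt (𝓡 m) x₀).map_source hx)) L (by simp)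
    (chartMetric_coframe_onb hx)
  rw [coframe_tension hψ hx (hvalue ▸ hy), coframe_tension hφ hx hy, hhess, htrace, htrace,
    euclideanTrace, Finset.mul_sum, Finset.sum_smul, ← Finset.sum_add_distrib]
  refine Finset.sum_congr rfl fun i _ ↦ ?_
  rw [_root_.add_apply, _root_.add_apply, fderiv_fderiv_norm_sub_sq_smul,
    real_inner_self_eq_norm_sq]

theorem normSq_tension_add_quadratic {φ ψ : M → N} (hφ : ContMDiff (𝓡 m) (𝓡 n) ∞ φ)
    (hψ : ContMDiff (𝓡 m) (𝓡 n) ∞ ψ) {x₀ : M} {σ : ℝ} (hvalue : ψ x₀ = φ x₀)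
    (hquad : chartMap m n ψ x₀ (φ x₀) =ᶠ[𝓝 (extChartAt (𝓡 m) x₀ x₀)]
      fun p ↦ chartMap m n φ x₀ (φ x₀) p
        + ‖p - extChartAt (𝓡 m) x₀ x₀‖ ^ 2 • σ • coframe (φ x₀) (φ x₀) (tension m n φ x₀)) :
    ‖tension m n ψ x₀‖ ^ 2
      = (1 + 2 * euclideanTrace m x₀ * σ) ^ 2 * ‖tension m n φ x₀‖ ^ 2 := by
  have hy := mem_extChartAt_source (I := 𝓡 n) (φ x₀)
  have hscale : coframe (φ x₀) (ψ x₀) (tension m n ψ x₀)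
      = (1 + 2 * euclideanTrace m x₀ * σ) • coframe (φ x₀) (φ x₀) (tension m n φ x₀) := by
    rw [coframe_tension_add_quadratic hφ hψ hvalue hquad, add_smul, one_smul, smul_smul]
  rw [← real_inner_self_eq_norm_sq, ← chartMetric_coframe (y₀ := φ x₀) (hvalue ▸ hy), hscale,
    hvalue]
  simp only [map_smul, _root_.smul_apply, smul_eq_mul]
  rw [chartMetric_coframe hy, real_inner_self_eq_norm_sq]
  ring

theorem isHarmonic_of_isFBiharmonic [T2Space M] [SecondCountableTopology M] [MeasurableSpace M]
    [BorelSpace M] {φ : M → N} (hφ : ContMDiff (𝓡 m) (𝓡 n) ∞ φ)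
    (h : ∀ f : M → ℝ, ContMDiff (𝓡 m) 𝓘(ℝ, ℝ) ∞ f → (∀ x, 0 < f x) → IsFBiharmonic m n φ f) :
    IsHarmonic m n φ := by
  intro x₀
  rcases eq_or_ne m 0 with rfl | hm
  · simp [tension]
  obtain ⟨K, Φ, δ, hK, hΦ, hδ, hvalue, hquad⟩ := exists_quadratic_variation hφ x₀
    (coframe (φ x₀) (φ x₀) (tension m n φ x₀))
  have hnormSq : (fun t ↦ ‖tension m n (Φ t) x₀‖ ^ 2)
      = fun t ↦ (1 + 2 * euclideanTrace m x₀ * (δ * Real.sin t)) ^ 2 * ‖tension m n φ x₀‖ ^ 2 :=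
    funext fun t ↦ normSq_tension_add_quadratic hφ (contMDiff_of_family hΦ.smooth t) (hvalue t)
      (hquad t)
  have hderiv : HasDerivAt (fun t ↦ ‖tension m n (Φ t) x₀‖ ^ 2)
      (4 * euclideanTrace m x₀ * δ * ‖tension m n φ x₀‖ ^ 2) 0 := by
    rw [hnormSq]
    refine (((((Real.hasDerivAt_sin 0).const_mul δ).const_mul (2 * euclideanTrace m x₀)).const_add
      1).pow 2 |>.mul_const (‖tension m n φ x₀‖ ^ 2)).congr_deriv ?_
    simp only [Real.sin_zero, Real.cos_zero]
    push_cast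
    ring
  have hstationary := hderiv.deriv.symm.trans (deriv_normSq_tension_eq_zero h hK hΦ x₀)
  have htrace := euclideanTrace_pos hm x₀
  have hfactor : 4 * euclideanTrace m x₀ * δ ≠ 0 := by positivity
  simpa [hfactor] using hstationary

end SecondVariation

end FBiharm

end

theorem corollary2p3_general {m n : ℕ}
    {M : Type*} [TopologicalSpace M] [T2Space M] [SecondCountableTopology M]
    [MeasurableSpace M] [BorelSpace M]
    [ChartedSpace (EuclideanSpace ℝ (Fin m)) M] [IsManifold (𝓡 m) ∞ M]
    [RiemannianBundle (fun x : M ↦ TangentSpace (𝓡 m) x)]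
    [IsContMDiffRiemannianBundle (𝓡 m) ∞ (EuclideanSpace ℝ (Fin m))
      (fun x : M ↦ TangentSpace (𝓡 m) x)]
    {N : Type*} [TopologicalSpace N]
    [ChartedSpace (EuclideanSpace ℝ (Fin n)) N] [IsManifold (𝓡 n) ∞ N]
    [RiemannianBundle (fun y : N ↦ TangentSpace (𝓡 n) y)]
    [IsContMDiffRiemannianBundle (𝓡 n) ∞ (EuclideanSpace ℝ (Fin n))
      (fun y : N ↦ TangentSpace (𝓡 n) y)]
    (φ : M → N) (hφ : ContMDiff (𝓡 m) (𝓡 n) ∞ φ) :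
    (FBiharm.IsHarmonic m n φ ↔
      ∀ f : M → ℝ, ContMDiff (𝓡 m) 𝓘(ℝ, ℝ) ∞ f → (∀ x, 0 < f x) → FBiharm.IsFBiharmonic m n φ f) ∧
    (FBiharm.IsHarmonic m n φ ↔
      ∀ f : M → ℝ, ContMDiff (𝓡 m) 𝓘(ℝ, ℝ) ∞ f → (∀ x, 0 < f x) →
        ∀ x, FBiharm.fBitension m n φ f x = 0) :=
  ⟨⟨fun hharm _ hf _ ↦ FBiharm.isFBiharmonic_of_isHarmonic hharm hf.continuous,
      FBiharm.isHarmonic_of_isFBiharmonic hφ⟩,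
    ⟨fun hharm f _ _ ↦ FBiharm.fBitension_eq_zero_of_isHarmonic hφ.continuous hharm f,
      FBiharm.isHarmonic_of_fBitension_eq_zero⟩⟩

/-- An isometrically immersed submanifold `φ : M^m → (N^n, h)` is minimal if and only if it is
`f`-biharmonic for every positive smooth function `f`; this is stated both with `f`-biharmonicity as
criticality for the `f`-bienergy and with the `f`-biharmonic map equation `τ_{2,f}(φ) = 0`. -/
theorem corollary2p3 {m n : ℕ}
    {M : Type*} [TopologicalSpace M] [T2Space M] [SecondCountableTopology M]
    [MeasurableSpace M] [BorelSpace M]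
    [ChartedSpace (EuclideanSpace ℝ (Fin m)) M] [IsManifold (𝓡 m) ∞ M]
    [RiemannianBundle (fun x : M ↦ TangentSpace (𝓡 m) x)]
    [IsContMDiffRiemannianBundle (𝓡 m) ∞ (EuclideanSpace ℝ (Fin m))
      (fun x : M ↦ TangentSpace (𝓡 m) x)]
    {N : Type*} [TopologicalSpace N] [T2Space N] [SecondCountableTopology N]
    [ChartedSpace (EuclideanSpace ℝ (Fin n)) N] [IsManifold (𝓡 n) ∞ N]
    [RiemannianBundle (fun y : N ↦ TangentSpace (𝓡 n) y)]
    [IsContMDiffRiemannianBundle (𝓡 n) ∞ (EuclideanSpace ℝ (Fin n))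
      (fun y : N ↦ TangentSpace (𝓡 n) y)]
    (φ : M → N) (hφ : FBiharm.IsIsometricImmersion m n φ) :
    (FBiharm.IsMinimal m n φ ↔
      ∀ f : M → ℝ, ContMDiff (𝓡 m) 𝓘(ℝ, ℝ) ∞ f → (∀ x, 0 < f x) → FBiharm.IsFBiharmonic m n φ f) ∧
    (FBiharm.IsMinimal m n φ ↔
      ∀ f : M → ℝ, ContMDiff (𝓡 m) 𝓘(ℝ, ℝ) ∞ f → (∀ x, 0 < f x) →
        ∀ x, FBiharm.fBitension m n φ f x = 0) := by
  rw [FBiharm.isMinimal_iff_isHarmonic hφ]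
  exact corollary2p3_general φ hφ.smooth
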